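/- Let $\mathbb T=\mathbb R/2\pi\mathbb Z$ with Lebesgue measure, $e_n(x)=(2\pi)^{-1/2}e^{inx}$, and for $\phi\in L^2(\mathbb T)$ let $\widehat\phi(n)=\int_{\mathbb T}\overline{e_n}\,\phi\,dx$, $P_{\le N}\phi=\sum_{|n|\le N}\widehat\phi(n)e_n$ and $U(t)\phi=\sum_{n\in\mathbb Z}e^{-itn^2}\widehat\phi(n)e_n$. For a bounded operator $A$ on $L^2(\mathbb T)$ put $\|A\|_{\mathfrak S^\alpha}=(\operatorname{Tr}|A|^\alpha)^{1/\alpha}$, where $|A|=\sqrt{A^*A}$, and let $\mathfrak S^\alpha$ be the set of bounded operators for which this is finite. For a trace-class operator $A$ with singular value decomposition $A=\sum_{n\ge1}a_n|\phi_n\rangle\langle\psi_n|$, let $\rho_A=\sum_{n\ge1}a_n\phi_n\overline{\psi_n}$ be its density and $\bar\rho(A)=\rho_A-\frac1{2\pi}\operatorname{Tr}A$ its renormalised density. **Theorem ($L^3$ estimate for the renormalised density).** For every bounded operator $\gamma_0$ on $L^2(\mathbb T)$ and every $N$, the function $(t,x)\mapsto\bar\rho(U(t)P_{\le N}\gamma_0P_{\le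 N}U(t)^*)(x)$ on $[0,2\pi]\times\mathbb T$ has a jointly measurable version. For $\alpha,\sigma\in\mathbb R$ consider the estimate $$\big\|\bar\rho\big(U(t)P_{\le N}\gamma_0P_{\le N}U(t)^*\big)\big\|_{L^3_{t,x}([0,2\pi]\times\mathbb T)}\le C\,N^\sigma\,\|\gamma_0\|_{\mathfrak S^\alpha}\qquad\text{for all integers }N\ge1\text{ and all }\gamma_0\in\mathfrak S^\alpha,\tag{$*$}$$ with a constant $C$ that may depend on $\alpha$ and $\sigma$ but not on $N$ or $\gamma_0$. (i) Let $\alpha\in[2,3]$, and suppose that $\sigma\ge\frac13$ if $\alpha=3$ and $\sigma>\frac23-\frac1\alpha$ if $\alpha\in[2,3)$. Then there is a constant $C>0$ such that $(*)$ holds. (ii) Let $\alpha\in[\frac32,3]$ and $\sigma<\frac23-\frac1\alpha$. Then $(*)$ fails: there is no constant $C>0$ for which it holds. -/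

import Mathlib

open MeasureTheory Real
open scoped ENNReal NNReal ComplexConjugate

noncomputable section

namespace TorusStrichartz

instance fact_two_pi_pos : Fact (0 < 2 * π) := ⟨Real.two_pi_pos⟩

/-- The circle `ℝ / 2πℤ`; its `volume` is Lebesgue measure, of total mass `2π`. -/
abbrev Circ : Type := AddCircle (2 * π)

/-- The complex Hilbert space `L²(𝕋)` with respect to Lebesgue measure. -/
abbrev L2 : Type := Lp ℂ 2 (volume : Measure Circ)

/-- The function `e_n(x) = (2π)^{-1/2} e^{inx}` as an element of `L²(𝕋)`. -/
def e (n : ℤ) : L2 :=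
  ContinuousMap.toLp (E := ℂ) 2 (volume : Measure Circ) ℂ
    (((√(2 * π))⁻¹ : ℂ) • (fourier n : C(Circ, ℂ)))

theorem orthonormal_e : Orthonormal ℂ e := by
  rw [orthonormal_iff_ite]
  intro i j
  have h := orthonormal_iff_ite.1 (orthonormal_fourier (T := 2 * π)) i j
  rw [ContinuousMap.inner_toLp] at h
  unfold e
  rw [ContinuousMap.inner_toLp]
  rw [AddCircle.integral_haarAddCircle] at h
  have hpi : (0 : ℝ) < 2 * π := Real.two_pi_pos
  have hs : ((√(2 * π) : ℝ) : ℂ) * ((√(2 * π) : ℝ) : ℂ) = ((2 * π : ℝ) : ℂ) := by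
    rw [← Complex.ofReal_mul, Real.mul_self_sqrt hpi.le]
  have hc : (((√(2 * π) : ℝ) : ℂ))⁻¹ * (((√(2 * π) : ℝ) : ℂ))⁻¹ = (((2 * π)⁻¹ : ℝ) : ℂ) := by
    rw [← mul_inv, hs, Complex.ofReal_inv]
  rw [← h, Complex.real_smul, ← integral_const_mul]
  refine integral_congr_ae (Filter.Eventually.of_forall fun x => ?_)
  simp only [ContinuousMap.smul_apply, smul_eq_mul, map_mul, map_inv₀, Complex.conj_ofReal]
  rw [← hc]
  ring

theorem span_e_dense : ⊤ ≤ (Submodule.span ℂ (Set.range e)).topologicalClosure := by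
  have hc : (((√(2 * π) : ℝ) : ℂ))⁻¹ ≠ 0 := by
    have : √(2 * π) ≠ 0 := (Real.sqrt_pos.2 Real.two_pi_pos).ne'
    exact inv_ne_zero (Complex.ofReal_ne_zero.2 this)
  have h := (ContinuousMap.toLp_denseRange (p := 2) ℂ (volume : Measure Circ) ℂ
    (by norm_num)).topologicalClosure_map_submodule (span_fourier_closure_eq_top (T := 2 * π))
  rw [← h]
  refine Submodule.topologicalClosure_mono ?_
  rw [Submodule.map_span, Submodule.span_le]
  rintro _ ⟨_, ⟨n, rfl⟩, rfl⟩
  have h2 : ContinuousMap.toLp (E := ℂ) 2 (volume : Measure Circ) ℂ (fourier n)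
      = ((√(2 * π) : ℝ) : ℂ) • e n := by
    unfold e
    rw [map_smul, smul_smul, mul_inv_cancel₀ (fun h0 => hc (by rw [h0, inv_zero])), one_smul]
  have h3 : ContinuousMap.toLp (E := ℂ) 2 (volume : Measure Circ) ℂ (fourier n)
      ∈ Submodule.span ℂ (Set.range e) := by
    rw [h2]
    exact Submodule.smul_mem _ _ (Submodule.subset_span ⟨n, rfl⟩)
  exact h3

/-- The orthonormal basis `(e_n)_{n ∈ ℤ}` of `L²(𝕋)`. -/
def eBasis : HilbertBasis ℤ ℂ L2 := HilbertBasis.mk orthonormal_e span_e_dense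

/-- The phase `e^{-itn²}`. -/
def phase (t : ℝ) (n : ℤ) : ℂ := Complex.exp (-(Complex.I * t * (n : ℂ) ^ 2))

theorem norm_phase (t : ℝ) (n : ℤ) : ‖phase t n‖ = 1 := by
  have : -(Complex.I * t * (n : ℂ) ^ 2) = ((-(t * (n : ℝ) ^ 2) : ℝ) : ℂ) * Complex.I := by
    push_cast; ring
  rw [phase, this, Complex.norm_exp_ofReal_mul_I]

theorem orthonormal_phase (t : ℝ) : Orthonormal ℂ (fun n => phase t n • e n) := by
  refine ⟨fun n => ?_, fun i j hij => ?_⟩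
  · rw [norm_smul, norm_phase, one_mul, orthonormal_e.1 n]
  · have := orthonormal_e.2 hij
    simp only [inner_smul_left, inner_smul_right]
    rw [this, mul_zero, mul_zero]

theorem span_phase_dense (t : ℝ) :
    ⊤ ≤ (Submodule.span ℂ (Set.range fun n => phase t n • e n)).topologicalClosure := by
  refine span_e_dense.trans (Submodule.topologicalClosure_mono ?_)
  rw [Submodule.span_le]
  rintro _ ⟨n, rfl⟩
  have hne : phase t n ≠ 0 := by
    intro h
    have := norm_phase t n
    rw [h, norm_zero] at this
    exact zero_ne_one this
  have h : e n = (phase t n)⁻¹ • (phase t n • e n) := by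
    rw [smul_smul, inv_mul_cancel₀ hne, one_smul]
  have h2 : (phase t n)⁻¹ • (phase t n • e n)
      ∈ Submodule.span ℂ (Set.range fun n => phase t n • e n) :=
    Submodule.smul_mem _ _ (Submodule.subset_span ⟨n, rfl⟩)
  rw [← h] at h2
  exact h2

/-- The free Schrödinger propagator `U(t) = e^{itΔ}` on `L²(𝕋)`: the bounded operator that sends
`∑ c_n e_n` to `∑ c_n e^{-itn²} e_n` (see `hasSum_U`). -/
def U (t : ℝ) : L2 →L[ℂ] L2 :=
  (eBasis.repr.trans
    (HilbertBasis.mk (orthonormal_phase t) (span_phase_dense t)).repr.symm :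
      L2 ≃ₗᵢ[ℂ] L2).toContinuousLinearEquiv

theorem hasSum_U (t : ℝ) (f : L2) :
    HasSum (fun n : ℤ => (phase t n * inner ℂ (e n) f) • e n) (U t f) := by
  have h := (HilbertBasis.mk (orthonormal_phase t) (span_phase_dense t)).hasSum_repr_symm
    (eBasis.repr f)
  convert! h using 1
  funext n
  rw [HilbertBasis.coe_mk, HilbertBasis.repr_apply_apply, smul_smul, eBasis, HilbertBasis.coe_mk,
    mul_comm (phase t n)]

/-- The Dirichlet projection `P_{≤N} f = ∑_{|n| ≤ N} ⟪e_n, f⟫ e_n`. -/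
def P (N : ℕ) : L2 →L[ℂ] L2 :=
  ∑ n ∈ Finset.Icc (-(N : ℤ)) (N : ℤ), InnerProductSpace.rankOne ℂ (e n) (e n)

/-- The Schatten norm `(Tr |A|^α)^{1/α} ∈ [0, ∞]` of a bounded operator on a Hilbert space, for real
`α ≥ 1`. Here `|A| = √(A* A)` and `|A|^α` are given by the continuous functional calculus, and the
trace of the positive operator `|A|^α` is the sum of its diagonal entries in the orthonormal basis
`b` (this sum does not depend on `b`). -/
def schattenNormOf {ι H : Type*} [NormedAddCommGroup H] [InnerProductSpace ℂ H] [CompleteSpace H]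
    (b : HilbertBasis ι ℂ H) (α : ℝ) (A : H →L[ℂ] H) : ℝ≥0∞ :=
  (∑' i : ι, ENNReal.ofReal (inner ℂ (b i) (((CFC.abs A) ^ α : H →L[ℂ] H) (b i))).re) ^ (1 / α)

/-- The Schatten norm of a bounded operator on `L²(𝕋)`. -/
def schattenNorm (α : ℝ) (A : L2 →L[ℂ] L2) : ℝ≥0∞ := schattenNormOf eBasis α A

/-- The trace of a trace-class operator. -/
def trace (A : L2 →L[ℂ] L2) : ℂ := ∑' n : ℤ, inner ℂ (e n) (A (e n))

/-- `A = ∑ a_n |φ_n⟩⟨ψ_n|` is a singular value decomposition of `A`. -/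
structure IsSVD (A : L2 →L[ℂ] L2) (a : ℕ → ℝ) (φ ψ : ℕ → L2) : Prop where
  antitone : Antitone a
  nonneg : ∀ n, 0 ≤ a n
  orthonormal_left : Orthonormal ℂ φ
  orthonormal_right : Orthonormal ℂ ψ
  hasSum : HasSum (fun n => (a n : ℂ) • InnerProductSpace.rankOne ℂ (φ n) (ψ n)) A

open Classical in
/-- The density `ρ_A(x) = ∑ a_n φ_n(x) conj (ψ_n(x))` of a trace-class operator `A`, where
`A = ∑ a_n |φ_n⟩⟨ψ_n|` is a singular value decomposition. It is determined up to null sets, and is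
only meaningful for trace-class operators; operators that have no singular value decomposition
get the value `0`. -/
def density (A : L2 →L[ℂ] L2) : Circ → ℂ :=
  if h : ∃ s : (ℕ → ℝ) × (ℕ → L2) × (ℕ → L2), IsSVD A s.1 s.2.1 s.2.2 then
    fun x => ∑' n, (h.choose.1 n : ℂ) * (h.choose.2.1 n : Circ → ℂ) x *
      conj ((h.choose.2.2 n : Circ → ℂ) x)
  else 0

/-- The renormalised density `ρ_A(x) - (2π)⁻¹ Tr A` of a trace-class operator `A`. -/
def renDensity (A : L2 →L[ℂ] L2) : Circ → ℂ :=
  fun x => density A x - (2 * π : ℂ)⁻¹ * trace A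

/-- The renormalised density, at time `t`, of the (finite rank) operator
`U(t) P_{≤N} γ₀ P_{≤N} U(t)*`. -/
def renDensityAt (N : ℕ) (γ₀ : L2 →L[ℂ] L2) (t : ℝ) : Circ → ℂ :=
  renDensity (U t ∘L P N ∘L γ₀ ∘L P N ∘L ContinuousLinearMap.adjoint (U t))

/-- Lebesgue measure on the space-time torus, realised as `[0, 2π] × 𝕋`. -/
def spaceTime : Measure (ℝ × Circ) :=
  ((volume : Measure ℝ).restrict (Set.Icc 0 (2 * π))).prod (volume : Measure Circ)

/-- `F` is a (jointly measurable) function of `(t, x)` that represents the time-dependent function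
class `g` on `[0, 2π] × 𝕋`. By Tonelli's theorem, such an `F` is unique up to null sets. -/
def Represents (F : ℝ × Circ → ℂ) (g : ℝ → Circ → ℂ) : Prop :=
  AEStronglyMeasurable F spaceTime ∧
    ∀ᵐ t ∂((volume : Measure ℝ).restrict (Set.Icc 0 (2 * π))),
      (fun x => F (t, x)) =ᵐ[volume] g t

/-- The estimate `‖ρ̄(U(t) P_{≤N} γ₀ P_{≤N} U(t)*)‖_{L³_{t,x}} ≤ C N^σ ‖γ₀‖_{𝔖^α}` holds with a
constant independent of `N ≥ 1` and of `γ₀ ∈ 𝔖^α`. -/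
def L3Estimate (α σ : ℝ) : Prop :=
  ∃ C : ℝ, 0 < C ∧ ∀ N : ℕ, 1 ≤ N → ∀ γ₀ : L2 →L[ℂ] L2, schattenNorm α γ₀ < ∞ →
    ∀ F : ℝ × Circ → ℂ, Represents F (renDensityAt N γ₀) →
      eLpNorm F 3 spaceTime ≤ ENNReal.ofReal (C * (N : ℝ) ^ σ) * schattenNorm α γ₀

end TorusStrichartz

end

namespace TorusStrichartz

/-! The entry ⟨e_m, γ e_n⟩ enters the density with space-time frequency (m - n, m² - n²). For m ≠ n
this pair determines (m, n), while all diagonal entries sit at frequency zero and are removed with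
the trace. So the renormalised density is a trigonometric polynomial, `trigDensity`, with distinct
frequencies, and its L² norm is at most the Hilbert–Schmidt norm of γ, without loss in N. Its fourth
moment is governed by the number of pairs of frequencies with a given nonzero difference; the
divisor bound makes this O(N^{1+ε}) (`card_freq_sub_le`), and Hölder between L² and L⁴ gives 𝔖² → L³
with loss N^{1/6+ε}. Pairing γ with a truncated delta function bounds the density pointwise by N‖γ‖
(`norm_trigDensity_le`).

The endpoint α = 3 costs no ε (`lintegral_trigDensity_pow_three_le`). Cut the singular values of γ
at height μ. The low part contributes at most Nμ pointwise, so (|ρ̄|/N - μ)₊ is controlled in L² by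
the high part, whose squared Hilbert–Schmidt norm is Tr (|γ| - μ)₊². Integrating over μ recovers
|ρ̄|³ on one side and Tr |γ|³ on the other. For 2 ≤ α < 3 one cut at a balanced height suffices: the
high part uses 𝔖² → L³, the low part 𝔖³ → L³, and the strict inequality for σ absorbs the ε.

For necessity, γ is the truncated shift e_n ↦ e_{n+1}. Its density terms share the spatial frequency
1 and add up coherently for 0 ≤ t ≤ 1/(2N), so the L³ norm is at least of order N^{2/3}, while the
Schatten norm is (2N)^{1/α}.

What links this to the statement is `renDensityAt_ae`: any singular value decomposition, in
particular an arbitrarily chosen one, produces the same density almost everywhere. -/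

/-! ### The divisor bound -/

/-- A number `n ≥ 1` has at most `C n ^ ε` divisors. -/
theorem exists_card_divisors_le_rpow {ε : ℝ} (hε : 0 < ε) :
    ∃ C : ℝ, 1 ≤ C ∧ ∀ n : ℕ, n ≠ 0 → (n.divisors.card : ℝ) ≤ C * (n : ℝ) ^ ε := by
  set c : ℝ := max 1 ((ε * Real.log 2)⁻¹) with hc
  have hlog : 0 < ε * Real.log 2 := mul_pos hε (Real.log_pos one_lt_two)
  have hc1 : 1 ≤ c := le_max_left _ _
  -- A prime p ≥ K satisfies p^ε ≥ 2, so its factor a + 1 ≤ 2^a is at most p^{aε}. Only the fewer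
  -- than K + 1 primes below K cost a factor c each, with c chosen so that 1 + y ≤ exp y applies
  -- with y = aε log 2.
  obtain ⟨K, hK⟩ := exists_nat_ge ((2 : ℝ) ^ (1 / ε))
  have small (p a : ℕ) (hp : 2 ≤ p) : (a + 1 : ℝ) ≤ c * ((p : ℝ) ^ a) ^ ε := by
    have hp' : (2 : ℝ) ≤ p := by exact_mod_cast hp
    have h1 : ((2 : ℝ) ^ a) ^ ε ≤ ((p : ℝ) ^ a) ^ ε := by gcongr
    have h2 : ((2 : ℝ) ^ a) ^ ε = Real.exp (a * (ε * Real.log 2)) := by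
      rw [Real.rpow_def_of_pos (by positivity), Real.log_pow]; ring_nf
    have h3 : a * (ε * Real.log 2) + 1 ≤ Real.exp (a * (ε * Real.log 2)) := Real.add_one_le_exp _
    have h4 : (ε * Real.log 2)⁻¹ * (a * (ε * Real.log 2)) = a := by field_simp
    calc (a + 1 : ℝ) ≤ c * (a * (ε * Real.log 2)) + c * 1 := by
          refine add_le_add (h4.symm.le.trans ?_) (by linarith)
          exact mul_le_mul_of_nonneg_right (le_max_right _ _) (by positivity)
      _ = c * (a * (ε * Real.log 2) + 1) := by ring
      _ ≤ c * ((p : ℝ) ^ a) ^ ε := by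
          refine mul_le_mul_of_nonneg_left ?_ (by linarith)
          rw [h2] at h1
          exact h3.trans h1
  have large (p a : ℕ) (hp : K ≤ p) : (a + 1 : ℝ) ≤ ((p : ℝ) ^ a) ^ ε := by
    have hp' : (2 : ℝ) ^ (1 / ε) ≤ p := hK.trans (by exact_mod_cast hp)
    have h1 : (2 : ℝ) ≤ (p : ℝ) ^ ε := by
      calc (2 : ℝ) = ((2 : ℝ) ^ (1 / ε)) ^ ε := by
            rw [← Real.rpow_mul (by norm_num), one_div_mul_cancel hε.ne', Real.rpow_one]
        _ ≤ (p : ℝ) ^ ε := by gcongr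
    have h2 : ((p : ℝ) ^ a) ^ ε = ((p : ℝ) ^ ε) ^ a := by
      rw [← Real.rpow_natCast, ← Real.rpow_natCast, ← Real.rpow_mul (by positivity),
        ← Real.rpow_mul (by positivity), mul_comm]
    rw [h2]
    refine le_trans ?_ (pow_le_pow_left₀ (by norm_num) h1 a)
    exact_mod_cast Nat.succ_le_of_lt Nat.lt_two_pow_self
  refine ⟨c ^ K, one_le_pow₀ hc1, fun n hn => ?_⟩
  have hn' : (n : ℝ) ^ ε = ∏ p ∈ n.primeFactors, ((p : ℝ) ^ n.factorization p) ^ ε := by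
    rw [Real.finsetProd_rpow _ _ (fun p _ => by positivity)]
    congr 1
    exact_mod_cast (Nat.prod_factorization_pow_eq_self hn).symm
  rw [Nat.card_divisors hn, hn']
  push_cast
  calc ∏ p ∈ n.primeFactors, ((n.factorization p : ℝ) + 1)
      ≤ ∏ p ∈ n.primeFactors,
          ((if p < K then c else 1) * ((p : ℝ) ^ n.factorization p) ^ ε) := by
        refine Finset.prod_le_prod (fun p _ => by positivity) fun p hp => ?_
        split_ifs with h
        · exact small p _ (Nat.prime_of_mem_primeFactors hp).two_le
        · rw [one_mul]; exact large p _ (not_lt.1 h)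
    _ = c ^ (n.primeFactors.filter (· < K)).card *
          ∏ p ∈ n.primeFactors, ((p : ℝ) ^ n.factorization p) ^ ε := by
        rw [Finset.prod_mul_distrib, Finset.prod_ite, Finset.prod_const, Finset.prod_const_one,
          mul_one]
    _ ≤ c ^ K * ∏ p ∈ n.primeFactors, ((p : ℝ) ^ n.factorization p) ^ ε := by
        refine mul_le_mul_of_nonneg_right (pow_le_pow_right₀ hc1 ?_)
          (Finset.prod_nonneg fun p _ => by positivity)
        calc (n.primeFactors.filter (· < K)).card ≤ (Finset.range K).card :=
              Finset.card_le_card fun p hp => by simpa using (Finset.mem_filter.1 hp).2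
          _ = K := Finset.card_range K

/-! ### Frequencies of the off-diagonal terms and their coincidences -/

/-- The frequency in `(x, t)` of the term `(m, n)` of the density. -/
def freq (q : ℤ × ℤ) : ℤ × ℤ := (q.1 - q.2, q.1 ^ 2 - q.2 ^ 2)

/-- Dividing m² - n² by m - n ≠ 0 recovers m + n, and sum and difference determine the pair. -/
theorem freq_injOn (N : ℕ) :
    Set.InjOn freq ((Finset.Icc (-(N : ℤ)) N).offDiag : Set (ℤ × ℤ)) := by
  rintro ⟨a, b⟩ hab ⟨c, d⟩ - h
  simp only [Finset.coe_offDiag, Set.mem_offDiag] at hab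
  simp only [freq, Prod.mk.injEq] at h
  obtain ⟨h1, h2⟩ := h
  have h3 : a - b ≠ 0 := sub_ne_zero.2 hab.2.2
  have h4 : (a - b) * (a + b) = (a - b) * (c + d) := by
    calc (a - b) * (a + b) = a ^ 2 - b ^ 2 := by ring
      _ = (c - d) * (c + d) := by rw [h2]; ring
      _ = (a - b) * (c + d) := by rw [h1]
  have h5 := mul_left_cancel₀ h3 h4
  ext <;> simp only <;> omega

theorem card_dvd_le {M : ℕ} {z : ℤ} (hz : z ≠ 0) {D : ℕ} (hD : z.natAbs.divisors.card ≤ D) :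
    ((Finset.Icc (-(M : ℤ)) M).filter (fun k => k ∣ z)).card ≤ 2 * D := by
  have h : (Finset.Icc (-(M : ℤ)) M).filter (fun k => k ∣ z) ⊆
      z.natAbs.divisors.image (fun d : ℕ => (d : ℤ)) ∪
        z.natAbs.divisors.image (fun d : ℕ => -(d : ℤ)) := by
    intro k hk
    have hk := (Finset.mem_filter.1 hk).2
    have hk' : k.natAbs ∈ z.natAbs.divisors := by
      rw [Nat.mem_divisors]
      exact ⟨Int.natAbs_dvd_natAbs.2 hk, Int.natAbs_ne_zero.2 hz⟩
    rw [Finset.mem_union, Finset.mem_image, Finset.mem_image]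
    rcases Int.natAbs_eq k with h | h
    · exact Or.inl ⟨_, hk', h.symm⟩
    · exact Or.inr ⟨_, hk', h.symm⟩
  refine (Finset.card_le_card h).trans ((Finset.card_union_le _ _).trans ?_)
  rw [two_mul]
  exact add_le_add (Finset.card_image_le.trans hD) (Finset.card_image_le.trans hD)

/-- The number of pairs of frequencies with a given nonzero difference. -/
theorem card_freq_sub_le {N D : ℕ}
    (hD : ∀ n : ℕ, n ≤ 64 * N ^ 2 → n.divisors.card ≤ D) (w : ℤ × ℤ) (hw : w ≠ 0) :
    ((((Finset.Icc (-(N : ℤ)) N).offDiag ×ˢ (Finset.Icc (-(N : ℤ)) N).offDiag)).filter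
      (fun q => freq q.1 - freq q.2 = w)).card ≤ (4 * N + 1) * (2 * D + 1) := by
  obtain ⟨A, B⟩ := w
  set I := Finset.Icc (-(N : ℤ)) N with hI
  set J := Finset.Icc (-((2 * N : ℕ) : ℤ)) ((2 * N : ℕ) : ℤ) with hJ
  set S := ((I.offDiag ×ˢ I.offDiag)).filter (fun q => freq q.1 - freq q.2 = (A, B)) with hS
  have hJc : J.card = 4 * N + 1 := by
    rw [hJ, Int.card_Icc]; push_cast; omega
  -- With d, s the difference and sum of each pair, the equations d₁ - d₂ = A and d₁s₁ - d₂s₂ = B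
  -- give d₂(s₁ - s₂) = B - A s₁. Hence (s₁, d₂) determines the quadruple, and d₂ divides B - A s₁.
  set T := (J ×ˢ J).filter (fun p => p.2 ∣ B - A * p.1) with hT
  have key (q : (ℤ × ℤ) × (ℤ × ℤ)) (hq : q ∈ S) : (-(N : ℤ) ≤ q.1.1 ∧ q.1.1 ≤ N) ∧
      (-(N : ℤ) ≤ q.1.2 ∧ q.1.2 ≤ N) ∧ (-(N : ℤ) ≤ q.2.1 ∧ q.2.1 ≤ N) ∧
      (-(N : ℤ) ≤ q.2.2 ∧ q.2.2 ≤ N) ∧ q.2.1 - q.2.2 ≠ 0 ∧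
      q.1.1 - q.1.2 = q.2.1 - q.2.2 + A ∧
      (q.2.1 - q.2.2) * (q.1.1 + q.1.2 - (q.2.1 + q.2.2)) = B - A * (q.1.1 + q.1.2) := by
    rw [hS, Finset.mem_filter, Finset.mem_product, Finset.mem_offDiag, Finset.mem_offDiag, hI,
      Finset.mem_Icc, Finset.mem_Icc, Finset.mem_Icc, Finset.mem_Icc] at hq
    obtain ⟨⟨⟨h1, h2, h3⟩, h4, h5, h6⟩, h7⟩ := hq
    simp only [freq, Prod.mk_sub_mk, Prod.mk.injEq] at h7
    refine ⟨h1, h2, h4, h5, sub_ne_zero.2 h6, by omega, ?_⟩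
    rw [← h7.1, ← h7.2]; ring
  obtain hS0 | ⟨q, hq⟩ := S.eq_empty_or_nonempty
  · simp [hS0]
  have hAB : (-(4 * N : ℤ) ≤ A ∧ A ≤ 4 * N) ∧ (-(2 * N ^ 2 : ℤ) ≤ B ∧ B ≤ 2 * N ^ 2) := by
    obtain ⟨h1, h2, h3, h4, -, h6, -⟩ := key q hq
    have h7 : freq q.1 - freq q.2 = (A, B) := (Finset.mem_filter.1 hq).2
    simp only [freq, Prod.mk_sub_mk, Prod.mk.injEq] at h7
    refine ⟨⟨by omega, by omega⟩, ?_⟩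
    rw [← h7.2]
    have := sq_le_sq' h1.1 h1.2
    have := sq_le_sq' h2.1 h2.2
    have := sq_le_sq' h3.1 h3.2
    have := sq_le_sq' h4.1 h4.2
    constructor <;> nlinarith [sq_nonneg q.1.1, sq_nonneg q.1.2, sq_nonneg q.2.1, sq_nonneg q.2.2]
  obtain ⟨⟨hA1, hA2⟩, hB1, hB2⟩ := hAB
  have h1 : S.card ≤ T.card := by
    refine Finset.card_le_card_of_injOn (fun q => (q.1.1 + q.1.2, q.2.1 - q.2.2)) ?_ ?_
    · intro q hq
      obtain ⟨h1, h2, h3, h4, h5, h6, h7⟩ := key q hq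
      simp only [hT, hJ, Finset.coe_filter, Finset.mem_product, Finset.mem_Icc, Set.mem_ofPred_eq]
      refine ⟨⟨⟨?_, ?_⟩, ?_, ?_⟩, Dvd.intro _ h7⟩ <;> push_cast <;> omega
    · intro q hq q' hq' h
      obtain ⟨-, -, -, -, h5, h6, h7⟩ := key q hq
      obtain ⟨-, -, -, -, -, h6', h7'⟩ := key q' hq'
      simp only [Prod.mk.injEq] at h
      obtain ⟨ha, hb⟩ := h
      rw [← ha, ← hb] at h7'
      have h8 := mul_left_cancel₀ h5 (h7.trans h7'.symm)
      obtain ⟨⟨a, b⟩, ⟨c, d⟩⟩ := q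
      obtain ⟨⟨a', b'⟩, ⟨c', d'⟩⟩ := q'
      simp only at *
      ext <;> simp only <;> omega
  -- For fixed s₁ = l the divisor bound limits d₂ unless B = A l. In that degenerate case d₂ is
  -- free, but since (A, B) ≠ 0 it occurs for at most one l.
  have h2 : T ⊆ J.biUnion (fun l => if B - A * l = 0 then {l} ×ˢ J else
      {l} ×ˢ J.filter (fun k => k ∣ B - A * l)) := by
    intro p hp
    rw [hT, Finset.mem_filter, Finset.mem_product] at hp
    rw [Finset.mem_biUnion]
    refine ⟨p.1, hp.1.1, ?_⟩
    split_ifs <;> simp [hp.1.2, hp.2]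
  refine h1.trans ((Finset.card_le_card h2).trans (Finset.card_biUnion_le.trans ?_))
  calc ∑ l ∈ J, (if B - A * l = 0 then {l} ×ˢ J else
        {l} ×ˢ J.filter (fun k => k ∣ B - A * l)).card
      ≤ ∑ l ∈ J, ((if B - A * l = 0 then 4 * N + 1 else 0) + 2 * D) := by
        refine Finset.sum_le_sum fun l hl => ?_
        split_ifs with h
        · simp [hJc]
        · rw [Finset.card_product, Finset.card_singleton, one_mul, zero_add]
          refine card_dvd_le h (hD _ ?_)
          rw [hJ, Finset.mem_Icc] at hl
          push_cast at hl
          obtain ⟨l1, l2⟩ := hl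
          have : |B - A * l| ≤ 64 * (N : ℤ) ^ 2 := by
            rw [abs_le]
            constructor <;> nlinarith
          zify
          exact this
    _ = (∑ l ∈ J, if B - A * l = 0 then 4 * N + 1 else 0) + (4 * N + 1) * (2 * D) := by
        rw [Finset.sum_add_distrib, Finset.sum_const, hJc, smul_eq_mul]
    _ ≤ (4 * N + 1) + (4 * N + 1) * (2 * D) := by
        refine Nat.add_le_add_right ?_ _
        rw [← Finset.sum_filter, Finset.sum_const, smul_eq_mul]
        have : (J.filter (fun l => B - A * l = 0)).card ≤ 1 := by
          rw [Finset.card_le_one]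
          intro a ha b hb
          have ha := (Finset.mem_filter.1 ha).2
          have hb := (Finset.mem_filter.1 hb).2
          have hA : A ≠ 0 := by
            rintro rfl
            apply hw
            simp only [zero_mul, sub_zero] at ha
            rw [ha]; rfl
          exact mul_left_cancel₀ hA (by linarith)
        nlinarith
    _ = (4 * N + 1) * (2 * D + 1) := by ring

/-! ### Orthogonality of characters on the space-time torus -/

/-- The character `(t, x) ↦ e^{i(kx - ωt)}` of frequency `(k, ω)`. -/
noncomputable def char (w : ℤ × ℤ) (p : ℝ × Circ) : ℂ :=
  Complex.exp (-(Complex.I * p.1 * w.2)) * (fourier w.1 p.2 : ℂ)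

theorem continuous_char (w : ℤ × ℤ) : Continuous (char w) := by
  unfold char
  fun_prop

theorem norm_exp_neg_I_mul (t : ℝ) (n : ℤ) : ‖Complex.exp (-(Complex.I * t * n))‖ = 1 := by
  have : -(Complex.I * t * n) = ((-(t * n) : ℝ) : ℂ) * Complex.I := by
    push_cast; ring
  rw [this, Complex.norm_exp_ofReal_mul_I]

theorem norm_fourier_apply (n : ℤ) (x : Circ) : ‖(fourier n x : ℂ)‖ = 1 := by
  rw [fourier_apply, Circle.norm_coe]

theorem norm_char (w : ℤ × ℤ) (p : ℝ × Circ) : ‖char w p‖ = 1 := by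
  rw [char, norm_mul, norm_exp_neg_I_mul, norm_fourier_apply, one_mul]

theorem char_mul_conj (v w : ℤ × ℤ) (p : ℝ × Circ) :
    char v p * conj (char w p) = char (v - w) p := by
  unfold char
  rw [map_mul, ← Complex.exp_conj, ← fourier_neg, mul_mul_mul_comm, ← Complex.exp_add,
    ← fourier_add]
  simp only [Prod.fst_sub, Prod.snd_sub, map_neg, map_mul, Complex.conj_I, Complex.conj_ofReal,
    map_intCast]
  rw [← sub_eq_add_neg]
  congr 2
  push_cast
  ring

theorem char_zero (p : ℝ × Circ) : char 0 p = 1 := by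
  simp [char]

instance : IsFiniteMeasure spaceTime := by
  unfold spaceTime; infer_instance

theorem integral_fourier_circ (n : ℤ) :
    ∫ x : Circ, (fourier n x : ℂ) = if n = 0 then ((2 * π : ℝ) : ℂ) else 0 := by
  have h := orthonormal_iff_ite.1 (orthonormal_fourier (T := 2 * π)) 0 n
  rw [ContinuousMap.inner_toLp, AddCircle.integral_haarAddCircle] at h
  simp only [fourier_zero, map_one, mul_one] at h
  have hpi : (2 * π : ℝ) ≠ 0 := Real.two_pi_pos.ne'
  rw [inv_smul_eq_iff₀ hpi] at h
  rw [h]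
  simp [eq_comm]

theorem integral_exp_time (n : ℤ) :
    ∫ t in Set.Icc 0 (2 * π), Complex.exp (-(Complex.I * (t : ℝ) * n)) =
      if n = 0 then ((2 * π : ℝ) : ℂ) else 0 := by
  rw [integral_Icc_eq_integral_Ioc, ← intervalIntegral.integral_of_le Real.two_pi_pos.le]
  split_ifs with h
  · simp [h]
  · have hc : -(Complex.I * n) ≠ 0 := by simp [h]
    have : ∀ t : ℝ, Complex.exp (-(Complex.I * (t : ℝ) * n)) =
        Complex.exp (-(Complex.I * n) * t) := fun t => by ring_nf
    simp_rw [this]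
    rw [integral_exp_mul_complex hc]
    have h1 : -(Complex.I * n) * ((2 * π : ℝ) : ℂ) = ((-n : ℤ) : ℂ) * (2 * π * Complex.I) := by
      push_cast; ring
    rw [h1, Complex.exp_int_mul_two_pi_mul_I]
    simp

theorem integral_char (w : ℤ × ℤ) :
    ∫ p, char w p ∂spaceTime = if w = 0 then (((2 * π) ^ 2 : ℝ) : ℂ) else 0 := by
  unfold char spaceTime
  rw [integral_prod_mul (f := fun t : ℝ => Complex.exp (-(Complex.I * t * w.2)))
    (g := fun x : Circ => (fourier w.1 x : ℂ)), integral_exp_time, integral_fourier_circ]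
  obtain ⟨a, b⟩ := w
  simp only [Prod.mk_eq_zero]
  by_cases ha : a = 0 <;> by_cases hb : b = 0 <;> simp [ha, hb]
  ring

theorem integrable_of_continuous {E : Type*} [NormedAddCommGroup E]
    {g : ℝ × Circ → E} (hg : Continuous g) : Integrable g spaceTime := by
  have h : IsCompact ((Set.Icc 0 (2 * π)) ×ˢ (Set.univ : Set Circ)) :=
    isCompact_Icc.prod isCompact_univ
  have h2 : spaceTime = ((volume : Measure ℝ).prod (volume : Measure Circ)).restrict
      ((Set.Icc 0 (2 * π)) ×ˢ (Set.univ : Set Circ)) := by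
    rw [← Measure.prod_restrict, Measure.restrict_univ, spaceTime]
  rw [h2]
  exact hg.continuousOn.integrableOn_compact h

/-- Bessel's inequality for exponential sums in which at most `r` terms share a frequency. -/
theorem integral_norm_sq_sum_char_le {ι : Type*} (s : Finset ι) (v : ι → ℤ × ℤ) (c : ι → ℂ)
    (r : ℕ) (hr : ∀ i ∈ s, (s.filter (fun j => v j = v i)).card ≤ r) :
    ∫ p, ‖∑ i ∈ s, c i * char (v i) p‖ ^ 2 ∂spaceTime ≤
      (2 * π) ^ 2 * (r * ∑ i ∈ s, ‖c i‖ ^ 2) := by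
  have h1 : ((∫ p, ‖∑ i ∈ s, c i * char (v i) p‖ ^ 2 ∂spaceTime : ℝ) : ℂ) =
      ∑ i ∈ s, ∑ j ∈ s, if v i = v j then (((2 * π) ^ 2 : ℝ) : ℂ) * (c i * conj (c j)) else 0 := by
    rw [← integral_complex_ofReal]
    have h2 (p : ℝ × Circ) : ((‖∑ i ∈ s, c i * char (v i) p‖ ^ 2 : ℝ) : ℂ) =
        ∑ i ∈ s, ∑ j ∈ s, (c i * conj (c j)) * char (v i - v j) p := by
      push_cast
      rw [← Complex.mul_conj', map_sum, Finset.sum_mul_sum]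
      refine Finset.sum_congr rfl fun i _ => Finset.sum_congr rfl fun j _ => ?_
      rw [← char_mul_conj, map_mul]
      ring
    have hint (i j : ι) : Integrable (fun p => (c i * conj (c j)) * char (v i - v j) p)
        spaceTime := integrable_of_continuous (continuous_const.mul (continuous_char _))
    simp_rw [h2]
    rw [integral_finsetSum _ (fun i _ => integrable_finsetSum _ fun j _ => hint i j)]
    refine Finset.sum_congr rfl fun i _ => ?_
    rw [integral_finsetSum _ (fun j _ => hint i j)]
    refine Finset.sum_congr rfl fun j _ => ?_
    rw [integral_const_mul, integral_char]
    simp only [sub_eq_zero]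
    split_ifs
    · ring
    · simp
  have h0 : 0 ≤ ∫ p, ‖∑ i ∈ s, c i * char (v i) p‖ ^ 2 ∂spaceTime :=
    integral_nonneg fun p => by positivity
  have h3 : ∫ p, ‖∑ i ∈ s, c i * char (v i) p‖ ^ 2 ∂spaceTime =
      ‖((∫ p, ‖∑ i ∈ s, c i * char (v i) p‖ ^ 2 ∂spaceTime : ℝ) : ℂ)‖ := by
    rw [Complex.norm_real, Real.norm_of_nonneg h0]
  -- After |c_i c_j| ≤ (|c_i|² + |c_j|²)/2 both halves agree by this symmetry, and each index i is
  -- counted at most r times.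
  have hsymm : ∑ i ∈ s, ∑ j ∈ s, (if v i = v j then ‖c j‖ ^ 2 else 0) =
      ∑ i ∈ s, ∑ j ∈ s, (if v i = v j then ‖c i‖ ^ 2 else 0) := by
    rw [Finset.sum_comm]
    refine Finset.sum_congr rfl fun i _ => Finset.sum_congr rfl fun j _ => ?_
    simp [eq_comm]
  calc ∫ p, ‖∑ i ∈ s, c i * char (v i) p‖ ^ 2 ∂spaceTime
      ≤ ∑ i ∈ s, ∑ j ∈ s, if v i = v j then
          (2 * π) ^ 2 * ((‖c i‖ ^ 2 + ‖c j‖ ^ 2) / 2) else 0 := by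
        rw [h3, h1]
        refine (norm_sum_le _ _).trans (Finset.sum_le_sum fun i _ => (norm_sum_le _ _).trans
          (Finset.sum_le_sum fun j _ => ?_))
        split_ifs
        · rw [norm_mul, norm_mul, RCLike.norm_conj, Complex.norm_real,
            Real.norm_of_nonneg (by positivity)]
          refine mul_le_mul_of_nonneg_left ?_ (by positivity)
          nlinarith [sq_nonneg (‖c i‖ - ‖c j‖)]
        · simp
    _ = (2 * π) ^ 2 * (((∑ i ∈ s, ∑ j ∈ s, if v i = v j then ‖c i‖ ^ 2 else 0) +
          ∑ i ∈ s, ∑ j ∈ s, if v i = v j then ‖c j‖ ^ 2 else 0) / 2) := by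
        simp_rw [← Finset.sum_add_distrib, Finset.sum_div, Finset.mul_sum]
        refine Finset.sum_congr rfl fun i _ => Finset.sum_congr rfl fun j _ => ?_
        split_ifs <;> simp
    _ = (2 * π) ^ 2 * ∑ i ∈ s, ∑ j ∈ s, (if v i = v j then ‖c i‖ ^ 2 else 0) := by
        rw [hsymm, add_self_div_two]
    _ ≤ (2 * π) ^ 2 * (r * ∑ i ∈ s, ‖c i‖ ^ 2) := by
        refine mul_le_mul_of_nonneg_left ?_ (by positivity)
        rw [Finset.mul_sum]
        refine Finset.sum_le_sum fun i hi => ?_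
        rw [← Finset.sum_filter, Finset.sum_const, nsmul_eq_mul]
        refine mul_le_mul_of_nonneg_right ?_ (by positivity)
        have := hr i hi
        simp only [eq_comm] at this ⊢
        exact_mod_cast this

/-! ### L², L⁴, L³ and pointwise bounds for the renormalised density -/

/-- The pairs of distinct frequencies of size at most `N`. -/
noncomputable def pairs (N : ℕ) : Finset (ℤ × ℤ) := (Finset.Icc (-(N : ℤ)) N).offDiag

/-- The trigonometric polynomial that represents the renormalised density. -/
noncomputable def trigDensity (N : ℕ) (γ : L2 →L[ℂ] L2) (p : ℝ × Circ) : ℂ :=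
  ∑ q ∈ pairs N, ((2 * π : ℝ) : ℂ)⁻¹ * inner ℂ (e q.1) (γ (e q.2)) * char (freq q) p

theorem continuous_trigDensity (N : ℕ) (γ : L2 →L[ℂ] L2) : Continuous (trigDensity N γ) :=
  continuous_finsetSum _ fun _ _ => continuous_const.mul (continuous_char _)

theorem trigDensity_add (N : ℕ) (γ δ : L2 →L[ℂ] L2) (p : ℝ × Circ) :
    trigDensity N (γ + δ) p = trigDensity N γ p + trigDensity N δ p := by
  simp only [trigDensity, add_apply, inner_add_right, ← Finset.sum_add_distrib]
  exact Finset.sum_congr rfl fun q _ => by ring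

/-- The squared Hilbert–Schmidt norm of the matrix of `γ` off the diagonal. -/
noncomputable def offDiagSq (N : ℕ) (γ : L2 →L[ℂ] L2) : ℝ :=
  ∑ q ∈ pairs N, ‖(inner ℂ (e q.1) (γ (e q.2)) : ℂ)‖ ^ 2

theorem offDiagSq_nonneg (N : ℕ) (γ : L2 →L[ℂ] L2) : 0 ≤ offDiagSq N γ :=
  Finset.sum_nonneg fun _ _ => by positivity

theorem sum_coeff_sq (N : ℕ) (γ : L2 →L[ℂ] L2) :
    (2 * π) ^ 2 * ∑ q ∈ pairs N, ‖((2 * π : ℝ) : ℂ)⁻¹ * inner ℂ (e q.1) (γ (e q.2))‖ ^ 2 =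
      offDiagSq N γ := by
  rw [offDiagSq, Finset.mul_sum]
  refine Finset.sum_congr rfl fun q _ => ?_
  rw [norm_mul, norm_inv, Complex.norm_real, Real.norm_of_nonneg Real.two_pi_pos.le,
    ← mul_pow, mul_inv_cancel_left₀ Real.two_pi_pos.ne']

/-- Injectivity of the frequencies allows Bessel's inequality with multiplicity one; the mass (2π)²
of space-time cancels the squared normalisation of the coefficients. -/
theorem integral_norm_sq_trigDensity_le (N : ℕ) (γ : L2 →L[ℂ] L2) :
    ∫ p, ‖trigDensity N γ p‖ ^ 2 ∂spaceTime ≤ offDiagSq N γ := by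
  refine (integral_norm_sq_sum_char_le (pairs N) freq _ 1 fun i hi => ?_).trans_eq ?_
  · rw [Finset.card_le_one]
    intro a ha b hb
    rw [Finset.mem_filter] at ha hb
    exact freq_injOn N ha.1 hb.1 (ha.2.trans hb.2.symm)
  · rw [Nat.cast_one, one_mul, sum_coeff_sq]

-- The square |ρ̄|² splits into the constant S and an exponential sum R over differences of distinct
-- frequencies. Such differences are nonzero by injectivity, so the counting bound serves as the
-- multiplicity in Bessel's inequality for R.
set_option maxHeartbeats 800000 in
theorem integral_norm_pow_four_trigDensity_le {N D : ℕ}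
    (hD : ∀ n : ℕ, n ≤ 64 * N ^ 2 → n.divisors.card ≤ D) (γ : L2 →L[ℂ] L2) :
    ∫ p, ‖trigDensity N γ p‖ ^ 4 ∂spaceTime ≤
      (1 + (4 * N + 1) * (2 * D + 1)) * offDiagSq N γ ^ 2 := by
  set c : ℤ × ℤ → ℂ := fun q => ((2 * π : ℝ) : ℂ)⁻¹ * inner ℂ (e q.1) (γ (e q.2)) with hc
  set s := pairs N with hs
  set S : ℝ := ∑ q ∈ s, ‖c q‖ ^ 2 with hS
  have hS' : (2 * π) ^ 2 * S = offDiagSq N γ := sum_coeff_sq N γ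
  have hS0 : 0 ≤ S := Finset.sum_nonneg fun _ _ => by positivity
  set R : ℝ × Circ → ℂ := fun p => ∑ q ∈ s.offDiag,
    (c q.1 * conj (c q.2)) * char (freq q.1 - freq q.2) p with hR
  have hsplit (p : ℝ × Circ) : ((‖trigDensity N γ p‖ ^ 2 : ℝ) : ℂ) = S + R p := by
    have h1 : trigDensity N γ p = ∑ q ∈ s, c q * char (freq q) p := rfl
    rw [Complex.ofReal_pow, ← Complex.mul_conj', h1, map_sum, Finset.sum_mul_sum,
      ← Finset.sum_product', ← Finset.diag_union_offDiag,
      Finset.sum_union (Finset.disjoint_diag_offDiag s), Finset.sum_diag, hS, hR]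
    push_cast
    congr 1
    · refine Finset.sum_congr rfl fun q _ => ?_
      rw [Complex.mul_conj', norm_mul, norm_char, mul_one]
    · refine Finset.sum_congr rfl fun q _ => ?_
      rw [← char_mul_conj, map_mul]; ring
  have hRc : Continuous R :=
    continuous_finsetSum _ fun _ _ => continuous_const.mul (continuous_char _)
  have hbd (p : ℝ × Circ) : ‖trigDensity N γ p‖ ^ 4 ≤ 2 * S ^ 2 + 2 * ‖R p‖ ^ 2 := by
    have h1 : ‖trigDensity N γ p‖ ^ 2 ≤ S + ‖R p‖ := by
      have := congrArg norm (hsplit p)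
      rw [Complex.norm_real, Real.norm_of_nonneg (by positivity)] at this
      rw [this]
      refine (norm_add_le _ _).trans ?_
      rw [Complex.norm_real, Real.norm_of_nonneg hS0]
    calc ‖trigDensity N γ p‖ ^ 4 = (‖trigDensity N γ p‖ ^ 2) ^ 2 := by ring
      _ ≤ (S + ‖R p‖) ^ 2 := by gcongr
      _ ≤ 2 * S ^ 2 + 2 * ‖R p‖ ^ 2 := by nlinarith [sq_nonneg (S - ‖R p‖)]
  have hvol : spaceTime.real Set.univ = (2 * π) ^ 2 := by
    have h := integral_char 0
    simp only [char_zero, if_true, integral_const, Complex.real_smul, mul_one] at h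
    exact_mod_cast h
  have hsub : s.offDiag ⊆ s ×ˢ s := fun q hq => by
    rw [Finset.mem_offDiag] at hq
    exact Finset.mem_product.2 ⟨hq.1, hq.2.1⟩
  have hcount : ∀ q ∈ s.offDiag, (s.offDiag.filter
      (fun q' => freq q'.1 - freq q'.2 = freq q.1 - freq q.2)).card ≤
        (4 * N + 1) * (2 * D + 1) := by
    intro q hq
    refine le_trans (Finset.card_le_card ?_)
      (card_freq_sub_le hD (freq q.1 - freq q.2) fun h0 => ?_)
    · exact Finset.filter_subset_filter _ hsub
    · rw [Finset.mem_offDiag] at hq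
      exact hq.2.2 (freq_injOn N hq.1 hq.2.1 (sub_eq_zero.1 h0))
  have hRint : ∫ p, ‖R p‖ ^ 2 ∂spaceTime ≤
      (2 * π) ^ 2 * (((4 * N + 1) * (2 * D + 1)) * S ^ 2) := by
    refine (integral_norm_sq_sum_char_le s.offDiag (fun q => freq q.1 - freq q.2)
      (fun q => c q.1 * conj (c q.2)) _ hcount).trans ?_
    push_cast
    refine mul_le_mul_of_nonneg_left (mul_le_mul_of_nonneg_left ?_ (by positivity))
      (by positivity)
    rw [sq S, hS, Finset.sum_mul_sum, ← Finset.sum_product']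
    refine (Finset.sum_congr rfl fun q _ => ?_).trans_le
      (Finset.sum_le_sum_of_subset_of_nonneg hsub fun _ _ _ => by positivity)
    rw [norm_mul, RCLike.norm_conj, mul_pow]
  -- The factor 2 from (S + |R|)² ≤ 2S² + 2|R|² is absorbed here, since S is smaller than
  -- `offDiagSq` by (2π)² and only one of the two factors in S² is needed for the mass.
  have hpi : (2 : ℝ) ≤ (2 * π) ^ 2 := by nlinarith [Real.pi_gt_three]
  have hR2 : Integrable (fun p => ‖R p‖ ^ 2) spaceTime :=
    integrable_of_continuous (hRc.norm.pow 2)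
  calc ∫ p, ‖trigDensity N γ p‖ ^ 4 ∂spaceTime
      ≤ ∫ p, (2 * S ^ 2 + 2 * ‖R p‖ ^ 2) ∂spaceTime :=
        integral_mono (integrable_of_continuous ((continuous_trigDensity N γ).norm.pow 4))
          ((integrable_const _).add (hR2.const_mul 2)) hbd
    _ = (2 * π) ^ 2 * (2 * S ^ 2) + 2 * ∫ p, ‖R p‖ ^ 2 ∂spaceTime := by
        rw [integral_add (integrable_const _) (hR2.const_mul 2), integral_const,
          integral_const_mul, hvol, smul_eq_mul]
    _ ≤ (2 * π) ^ 2 * (2 * S ^ 2) +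
          2 * ((2 * π) ^ 2 * (((4 * N + 1) * (2 * D + 1)) * S ^ 2)) := by gcongr
    _ = 2 * ((1 + (4 * N + 1) * (2 * D + 1)) * ((2 * π) ^ 2 * S ^ 2)) := by ring
    _ ≤ (2 * π) ^ 2 * ((1 + (4 * N + 1) * (2 * D + 1)) * ((2 * π) ^ 2 * S ^ 2)) := by
        exact mul_le_mul_of_nonneg_right hpi (by positivity)
    _ = (1 + (4 * N + 1) * (2 * D + 1)) * offDiagSq N γ ^ 2 := by rw [← hS']; ring

/-- Cauchy–Schwarz for |ρ̄|³ = |ρ̄| · |ρ̄|² interpolates between the second and the fourth moment.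
-/
theorem integral_norm_pow_three_trigDensity_le {N D : ℕ}
    (hD : ∀ n : ℕ, n ≤ 64 * N ^ 2 → n.divisors.card ≤ D) (γ : L2 →L[ℂ] L2) :
    ∫ p, ‖trigDensity N γ p‖ ^ 3 ∂spaceTime ≤
      √(1 + (4 * N + 1) * (2 * D + 1)) * offDiagSq N γ ^ (3 / 2 : ℝ) := by
  set g : ℝ × Circ → ℝ := fun p => ‖trigDensity N γ p‖ with hg
  have hgc : Continuous g := (continuous_trigDensity N γ).norm
  have hX := offDiagSq_nonneg N γ
  have hmem (k : ℕ) : MemLp (fun p => g p ^ k) (ENNReal.ofReal 2) spaceTime := by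
    rw [ENNReal.ofReal_ofNat]
    refine (memLp_two_iff_integrable_sq (hgc.pow k).aestronglyMeasurable).2 ?_
    exact integrable_of_continuous ((hgc.pow k).pow 2)
  have h := integral_mul_le_Lp_mul_Lq_of_nonneg Real.HolderConjugate.two_two
    (μ := spaceTime) (f := fun p => g p ^ 1) (g := fun p => g p ^ 2)
    (Filter.Eventually.of_forall fun p => by positivity)
    (Filter.Eventually.of_forall fun p => by positivity) (hmem 1) (hmem 2)
  have h1 (p : ℝ × Circ) : g p ^ 1 * g p ^ 2 = g p ^ 3 := by ring
  have h2 (p : ℝ × Circ) : (g p ^ 1) ^ (2 : ℝ) = g p ^ 2 := by norm_num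
  have h3 (p : ℝ × Circ) : (g p ^ 2) ^ (2 : ℝ) = g p ^ 4 := by
    rw [Real.rpow_two]; ring
  simp_rw [h1, h2, h3, ← Real.sqrt_eq_rpow] at h
  refine h.trans ?_
  have hX' : offDiagSq N γ ^ (3 / 2 : ℝ) = √(offDiagSq N γ) * offDiagSq N γ := by
    rw [Real.sqrt_eq_rpow]
    nth_rw 3 [← Real.rpow_one (offDiagSq N γ)]
    rw [← Real.rpow_add' hX (by norm_num)]
    norm_num
  calc √(∫ p, g p ^ 2 ∂spaceTime) * √(∫ p, g p ^ 4 ∂spaceTime)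
      ≤ √(offDiagSq N γ) * √((1 + (4 * N + 1) * (2 * D + 1)) * offDiagSq N γ ^ 2) := by
        gcongr
        · exact integral_norm_sq_trigDensity_le N γ
        · exact integral_norm_pow_four_trigDensity_le hD γ
    _ = √(1 + (4 * N + 1) * (2 * D + 1)) * offDiagSq N γ ^ (3 / 2 : ℝ) := by
        rw [Real.sqrt_mul (by positivity), Real.sqrt_sq hX, hX']; ring

/-- The pointwise bound on the renormalised density. -/
theorem norm_trigDensity_le {N : ℕ} (hN : 1 ≤ N) (γ : L2 →L[ℂ] L2) (p : ℝ × Circ) :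
    ‖trigDensity N γ p‖ ≤ N * ‖γ‖ := by
  set I := Finset.Icc (-(N : ℤ)) N with hI
  have hcard : (I.card : ℝ) = 2 * N + 1 := by
    have : I.card = 2 * N + 1 := by rw [hI, Int.card_Icc]; omega
    rw [this]; push_cast; ring
  set u : ℤ → ℂ := fun n => char (n, n ^ 2) p with hu
  have hu1 (n : ℤ) : ‖u n‖ = 1 := norm_char _ p
  -- A delta function at (t, x), truncated in frequency and evolved: ⟨w, γw⟩ is 2π times the
  -- unrenormalised density there, and ‖w‖² = 2N + 1. The diagonal obeys the same bound.
  set w : L2 := ∑ n ∈ I, conj (u n) • e n with hw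
  have hwn : ‖w‖ ^ 2 = 2 * N + 1 := by
    have h := Orthonormal.inner_sum orthonormal_e (fun n => conj (u n)) (fun n => conj (u n)) I
    rw [← hw, inner_self_eq_norm_sq_to_K] at h
    simp only [Complex.conj_conj, Complex.mul_conj', hu1] at h
    rw [← hcard]
    have h' : ((‖w‖ ^ 2 : ℝ) : ℂ) = ((I.card : ℝ) : ℂ) := by
      push_cast
      simpa using h
    exact_mod_cast h'
  have hfull : inner ℂ w (γ w) = ∑ m ∈ I, ∑ n ∈ I,
      inner ℂ (e m) (γ (e n)) * char (freq (m, n)) p := by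
    rw [hw, map_sum, sum_inner]
    refine Finset.sum_congr rfl fun m _ => ?_
    rw [inner_sum]
    refine Finset.sum_congr rfl fun n _ => ?_
    rw [map_smul, inner_smul_left, inner_smul_right, Complex.conj_conj]
    have : char (freq (m, n)) p = u m * conj (u n) := by
      rw [hu, char_mul_conj]; rfl
    rw [this]
    ring
  have hdiag : ‖∑ n ∈ I, inner ℂ (e n) (γ (e n)) * char (freq (n, n)) p‖ ≤ (2 * N + 1) * ‖γ‖ := by
    rw [← hcard, ← nsmul_eq_mul, ← Finset.sum_const]
    refine norm_sum_le_of_le _ fun n _ => ?_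
    rw [norm_mul, norm_char, mul_one]
    refine (norm_inner_le_norm _ _).trans ?_
    have := γ.le_opNorm (e n)
    rw [orthonormal_e.1 n] at this ⊢
    linarith
  have hwn2 : ‖inner ℂ w (γ w)‖ ≤ (2 * N + 1) * ‖γ‖ := by
    refine (norm_inner_le_norm _ _).trans ?_
    rw [← hwn]
    nlinarith [γ.le_opNorm w, norm_nonneg w]
  have hsplit : trigDensity N γ p = ((2 * π : ℝ) : ℂ)⁻¹ * (inner ℂ w (γ w) -
      ∑ n ∈ I, inner ℂ (e n) (γ (e n)) * char (freq (n, n)) p) := by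
    rw [hfull, ← Finset.sum_product', ← Finset.diag_union_offDiag,
      Finset.sum_union (Finset.disjoint_diag_offDiag I), Finset.sum_diag, add_sub_cancel_left,
      trigDensity, Finset.mul_sum]
    exact Finset.sum_congr rfl fun q _ => by ring
  have hN' : (1 : ℝ) ≤ N := by exact_mod_cast hN
  rw [hsplit, norm_mul, norm_inv, Complex.norm_real, Real.norm_of_nonneg Real.two_pi_pos.le,
    inv_mul_le_iff₀ Real.two_pi_pos]
  refine (norm_sub_le _ _).trans ((add_le_add hwn2 hdiag).trans ?_)
  have := Real.pi_gt_three
  -- N ≥ 1 gives 4N + 2 ≤ 6N, and π > 3 makes the final constant 1.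
  have h6 : 2 * (2 * (N : ℝ) + 1) ≤ 2 * π * N := by nlinarith
  nlinarith [norm_nonneg γ]

/-! ### Cutting the singular values by functional calculus -/

section SpectralCut

variable {H : Type*} [NormedAddCommGroup H] [InnerProductSpace ℂ H] [CompleteSpace H] {ι : Type*}

/-- The trace of the positive operator `f(|A|)`, computed along the family `u`. -/
noncomputable def absTrace (u : ι → H) (f : ℝ → ℝ) (A : H →L[ℂ] H) : ℝ≥0∞ :=
  ∑' i, ENNReal.ofReal (inner ℂ (u i) (cfc f (CFC.abs A) (u i))).re

theorem schattenNormOf_eq (b : HilbertBasis ι ℂ H) (α : ℝ) (A : H →L[ℂ] H) :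
    schattenNormOf b α A = absTrace b (fun s => s ^ α) A ^ (1 / α) := by
  unfold schattenNormOf absTrace
  rw [CFC.rpow_eq_cfc_real (CFC.abs_nonneg A)]

theorem nonneg_of_mem_spectrum_abs (A : H →L[ℂ] H) {s : ℝ} (hs : s ∈ spectrum ℝ (CFC.abs A)) :
    0 ≤ s :=
  spectrum_nonneg_of_nonneg (CFC.abs_nonneg A) hs

theorem absTrace_mono (u : ι → H) {f g : ℝ → ℝ} (hf : Continuous f) (hg : Continuous g)
    (hfg : ∀ s, 0 ≤ s → f s ≤ g s) (A : H →L[ℂ] H) : absTrace u f A ≤ absTrace u g A := by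
  refine ENNReal.tsum_le_tsum fun i => ENNReal.ofReal_le_ofReal ?_
  have h : cfc f (CFC.abs A) ≤ cfc g (CFC.abs A) :=
    cfc_mono (fun s hs => hfg s (nonneg_of_mem_spectrum_abs A hs)) (by fun_prop) (by fun_prop)
  have h2 := ((ContinuousLinearMap.le_def _ _).1 h).re_inner_nonneg_right (u i)
  rw [sub_apply, inner_sub_right] at h2
  simpa using h2

theorem absTrace_const_mul (u : ι → H) {r : ℝ} (hr : 0 ≤ r) {f : ℝ → ℝ} (hf : Continuous f)
    (A : H →L[ℂ] H) :
    absTrace u (fun s => r * f s) A = ENNReal.ofReal r * absTrace u f A := by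
  unfold absTrace
  rw [cfc_const_mul r f (CFC.abs A) (by fun_prop), ← ENNReal.tsum_mul_left]
  refine tsum_congr fun i => ?_
  rw [← ENNReal.ofReal_mul hr, smul_apply, inner_smul_right_eq_smul]
  simp

/-- As A*A = |A|², multiplying A on the right by h(|A|) changes singular values s to |s h(s)|. This
replaces the polar decomposition. -/
theorem star_mul_self_mul_cfc (A : H →L[ℂ] H) {h : ℝ → ℝ} (hh : Continuous h) :
    star (A * cfc h (CFC.abs A)) * (A * cfc h (CFC.abs A)) =
      cfc (fun s => (s * h s) ^ 2) (CFC.abs A) := by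
  have hsa : IsSelfAdjoint (CFC.abs A) := (CFC.abs_nonneg A).isSelfAdjoint
  have h1 : star (cfc h (CFC.abs A)) = cfc h (CFC.abs A) := IsSelfAdjoint.cfc.star_eq
  have h2 : star A * A = cfc (fun s : ℝ => s ^ 2) (CFC.abs A) := by
    rw [← CFC.abs_sq, cfc_pow_id (R := ℝ) (CFC.abs A) 2 hsa]
  have h3 : (fun s : ℝ => (s * h s) ^ 2) = fun s => h s * (s ^ 2 * h s) := by
    funext s; ring
  rw [star_mul, h1, mul_assoc, ← mul_assoc (star A), h2, h3,
    cfc_mul h (fun s => s ^ 2 * h s) (CFC.abs A) (by fun_prop) (by fun_prop),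
    cfc_mul (fun s => s ^ 2) h (CFC.abs A) (by fun_prop) (by fun_prop)]

theorem tsum_norm_sq_mul_cfc (u : ι → H) (A : H →L[ℂ] H) {h : ℝ → ℝ} (hh : Continuous h) :
    ∑' i, ENNReal.ofReal (‖(A * cfc h (CFC.abs A)) (u i)‖ ^ 2) =
      absTrace u (fun s => (s * h s) ^ 2) A := by
  unfold absTrace
  rw [← star_mul_self_mul_cfc A hh]
  refine tsum_congr fun i => ?_
  congr 1
  rw [ContinuousLinearMap.star_eq_adjoint]
  have h1 := ContinuousLinearMap.adjoint_inner_right (A * cfc h (CFC.abs A)) (u i)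
    ((A * cfc h (CFC.abs A)) (u i))
  rw [inner_self_eq_norm_sq_to_K] at h1
  have h2 := congrArg Complex.re h1
  refine Eq.symm (h2.trans ?_)
  norm_cast

/-- The part of `A` whose singular values are cut off at height `μ`. -/
noncomputable def lowPart (μ : ℝ) (A : H →L[ℂ] H) : H →L[ℂ] H :=
  A * cfc (fun s => μ / max s μ) (CFC.abs A)

/-- The complement of `lowPart`: a singular value `s` is replaced by `(s - μ)₊`. -/
noncomputable def highPart (μ : ℝ) (A : H →L[ℂ] H) : H →L[ℂ] H :=
  A * cfc (fun s => 1 - μ / max s μ) (CFC.abs A)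

theorem continuous_div_max {μ : ℝ} (hμ : 0 < μ) : Continuous fun s : ℝ => μ / max s μ :=
  continuous_const.div (by fun_prop) fun _ => (lt_max_of_lt_right hμ).ne'

theorem mul_div_max {μ : ℝ} (hμ : 0 < μ) (s : ℝ) : s * (μ / max s μ) = min s μ := by
  rcases le_total s μ with h | h
  · rw [max_eq_right h, min_eq_left h, div_self hμ.ne', mul_one]
  · rw [max_eq_left h, min_eq_right h, mul_div_cancel₀ _ (hμ.trans_le h).ne']

theorem mul_one_sub_div_max {μ : ℝ} (hμ : 0 < μ) (s : ℝ) :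
    s * (1 - μ / max s μ) = max (s - μ) 0 := by
  rw [mul_sub, mul_one, mul_div_max hμ]
  rcases le_total s μ with h | h
  · rw [min_eq_left h, max_eq_right (by linarith), sub_self]
  · rw [min_eq_right h, max_eq_left (by linarith)]

theorem highPart_add_lowPart {μ : ℝ} (hμ : 0 < μ) (A : H →L[ℂ] H) :
    highPart μ A + lowPart μ A = A := by
  have hc := continuous_div_max hμ
  have hsa : IsSelfAdjoint (CFC.abs A) := (CFC.abs_nonneg A).isSelfAdjoint
  rw [highPart, lowPart, ← mul_add,
    ← cfc_add (CFC.abs A) (fun s => 1 - μ / max s μ) (fun s => μ / max s μ)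
      (continuous_const.sub hc).continuousOn hc.continuousOn]
  simp only [sub_add_cancel]
  rw [cfc_const_one ℝ (CFC.abs A) hsa, mul_one]

theorem tsum_norm_sq_highPart (u : ι → H) {μ : ℝ} (hμ : 0 < μ) (A : H →L[ℂ] H) :
    ∑' i, ENNReal.ofReal (‖highPart μ A (u i)‖ ^ 2) =
      absTrace u (fun s => max (s - μ) 0 ^ 2) A := by
  have hc := continuous_div_max hμ
  rw [highPart, tsum_norm_sq_mul_cfc u A (by fun_prop)]
  simp_rw [mul_one_sub_div_max hμ]

theorem star_mul_self_lowPart {μ : ℝ} (hμ : 0 < μ) (A : H →L[ℂ] H) :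
    star (lowPart μ A) * lowPart μ A = cfc (fun s => min s μ ^ 2) (CFC.abs A) := by
  rw [lowPart, star_mul_self_mul_cfc A (continuous_div_max hμ)]
  simp_rw [mul_div_max hμ]

theorem norm_lowPart_le {μ : ℝ} (hμ : 0 < μ) (A : H →L[ℂ] H) : ‖lowPart μ A‖ ≤ μ := by
  have h1 : ‖lowPart μ A‖ * ‖lowPart μ A‖ ≤ μ ^ 2 := by
    rw [← CStarRing.norm_star_mul_self, star_mul_self_lowPart hμ]
    refine norm_cfc_le (𝕜 := ℝ) (by positivity) fun s hs => ?_
    have hs0 := nonneg_of_mem_spectrum_abs A hs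
    have : 0 ≤ min s μ := le_min hs0 hμ.le
    rw [Real.norm_of_nonneg (by positivity)]
    gcongr
    exact min_le_right _ _
  nlinarith [norm_nonneg (lowPart μ A)]

/-- Uniqueness of the positive square root: min(|A|, μ) is positive and squares to the right
operator. -/
theorem abs_lowPart {μ : ℝ} (hμ : 0 < μ) (A : H →L[ℂ] H) :
    CFC.abs (lowPart μ A) = cfc (fun s => min s μ) (CFC.abs A) := by
  have h : CFC.abs (lowPart μ A) = CFC.sqrt (star (lowPart μ A) * lowPart μ A) := rfl
  rw [h, star_mul_self_lowPart hμ]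
  refine CFC.sqrt_unique ?_ (cfc_nonneg fun s hs => le_min (nonneg_of_mem_spectrum_abs A hs) hμ.le)
  rw [← cfc_mul (fun s => min s μ) (fun s => min s μ) (CFC.abs A) (by fun_prop) (by fun_prop)]
  simp_rw [sq]

theorem absTrace_lowPart (u : ι → H) {μ : ℝ} (hμ : 0 < μ) {f : ℝ → ℝ} (hf : Continuous f)
    (A : H →L[ℂ] H) : absTrace u f (lowPart μ A) = absTrace u (fun s => f (min s μ)) A := by
  unfold absTrace
  rw [abs_lowPart hμ, ← cfc_comp' f (fun s => min s μ) (CFC.abs A) (by fun_prop) (by fun_prop)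
    (CFC.abs_nonneg A).isSelfAdjoint]

/-- The layer-cake formula used twice in the endpoint α = 3: for the values of the density and for
the singular values. -/
theorem setLIntegral_sub_max_sq {s K : ℝ} (hs : 0 ≤ s) (hK : s ≤ K) :
    ∫⁻ μ in Set.Ioc 0 K, ENNReal.ofReal (max (s - μ) 0 ^ 2) = ENNReal.ofReal (s ^ 3 / 3) := by
  have hc : Continuous fun μ : ℝ => max (s - μ) 0 ^ 2 := by fun_prop
  rw [← ofReal_integral_eq_lintegral_ofReal
    (hc.integrableOn_Icc.mono_set Set.Ioc_subset_Icc_self)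
    (Filter.Eventually.of_forall fun μ => by positivity),
    ← intervalIntegral.integral_of_le (hs.trans hK)]
  congr 1
  rw [← intervalIntegral.integral_add_adjacent_intervals (hc.intervalIntegrable 0 s)
    (hc.intervalIntegrable s K)]
  have h1 : ∫ μ in (0 : ℝ)..s, max (s - μ) 0 ^ 2 = ∫ μ in (0 : ℝ)..s, (s - μ) ^ 2 := by
    refine intervalIntegral.integral_congr fun μ hμ => ?_
    rw [Set.uIcc_of_le hs] at hμ
    have : max (s - μ) 0 = s - μ := max_eq_left (by linarith [hμ.2])
    simp [this]
  have h2 : ∫ μ in s..K, max (s - μ) 0 ^ 2 = ∫ μ in s..K, (0 : ℝ) := by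
    refine intervalIntegral.integral_congr fun μ hμ => ?_
    rw [Set.uIcc_of_le hK] at hμ
    have : max (s - μ) 0 = 0 := max_eq_right (by linarith [hμ.1])
    simp [this]
  rw [h1, h2, intervalIntegral.integral_comp_sub_left (fun x => x ^ 2)]
  simp
  ring

/-- The scalar layer-cake identity holds at each point of the spectrum of |A|, which lies in [0,
‖A‖], and the μ-integral passes through the functional calculus and the diagonal matrix entries. -/
theorem setLIntegral_absTrace_le [Countable ι] (u : ι → H) (A : H →L[ℂ] H) :
    ∫⁻ μ in Set.Ioc 0 ‖A‖, absTrace u (fun s => max (s - μ) 0 ^ 2) A ≤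
      absTrace u (fun s => s ^ 3 / 3) A := by
  set a := CFC.abs A with ha
  set K := ‖A‖ with hK
  have hsa : IsSelfAdjoint a := (CFC.abs_nonneg A).isSelfAdjoint
  have hspec : ∀ s ∈ spectrum ℝ a, 0 ≤ s ∧ s ≤ K := fun s hs => by
    refine ⟨nonneg_of_mem_spectrum_abs A hs, ?_⟩
    -- The bound of the spectrum by the norm needs ‖1‖ = 1; on the zero space the spectrum is empty.
    rcases subsingleton_or_nontrivial H with hH | hH
    · have : Subsingleton (H →L[ℂ] H) := ⟨fun S T => by ext x; exact Subsingleton.elim _ _⟩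
      rw [spectrum.of_subsingleton] at hs
      exact hs.elim
    have := spectrum.norm_le_norm_of_mem hs
    rw [ha, CFC.norm_abs] at this
    exact (le_abs_self s).trans this
  have hbound : ∀ᵐ μ ∂(volume.restrict (Set.Ioc 0 K)), ∀ s ∈ spectrum ℝ a,
      ‖max (s - μ) 0 ^ 2‖ ≤ (fun _ => K ^ 2) μ := by
    refine (ae_restrict_iff' measurableSet_Ioc).2 (Filter.Eventually.of_forall fun μ hμ s hs => ?_)
    rw [norm_pow, Real.norm_of_nonneg (le_max_right _ _)]
    have := hspec s hs
    have h1 : max (s - μ) 0 ≤ K := max_le (by linarith [hμ.1]) (by linarith)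
    exact pow_le_pow_left₀ (le_max_right _ _) h1 2
  have hfin : HasFiniteIntegral (fun _ : ℝ => K ^ 2) (volume.restrict (Set.Ioc 0 K)) :=
    (integrable_const _).2
  have hcont : ContinuousOn (Function.uncurry fun μ s : ℝ => max (s - μ) 0 ^ 2)
      (Set.Ioc 0 K ×ˢ spectrum ℝ a) := by
    unfold Function.uncurry
    fun_prop
  have hint := integrableOn_cfc measurableSet_Ioc _ (fun _ => K ^ 2) a hcont hbound hfin hsa
  have hcfc := cfc_setIntegral measurableSet_Ioc _ (fun _ => K ^ 2) a hcont hbound hfin hsa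
  let ℓ (i : ι) : (H →L[ℂ] H) →L[ℝ] ℝ :=
    Complex.reCLM ∘L (((innerSL ℂ (u i)) ∘L
      (ContinuousLinearMap.apply ℂ H (u i))).restrictScalars ℝ)
  have hℓ (i : ι) (B : H →L[ℂ] H) : (inner ℂ (u i) (B (u i))).re = ℓ i B := rfl
  unfold absTrace
  simp_rw [hℓ]
  rw [lintegral_tsum fun i =>
    ((ℓ i).integrable_comp hint).aestronglyMeasurable.aemeasurable.ennreal_ofReal]
  refine (tsum_congr fun i => ?_).le
  have hpos (μ : ℝ) : 0 ≤ ℓ i (cfc (fun s => max (s - μ) 0 ^ 2) a) := by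
    have h0 : 0 ≤ cfc (fun s => max (s - μ) 0 ^ 2) a := cfc_nonneg fun s _ => by positivity
    exact ((ContinuousLinearMap.nonneg_iff_isPositive _).1 h0).re_inner_nonneg_right (u i)
  rw [← ofReal_integral_eq_lintegral_ofReal ((ℓ i).integrable_comp hint)
    (Filter.Eventually.of_forall hpos), ContinuousLinearMap.integral_comp_comm _ hint, ← hcfc]
  congr 2
  refine cfc_congr fun s hs => ?_
  have h1 := setLIntegral_sub_max_sq (hspec s hs).1 (hspec s hs).2
  have hc : Continuous fun μ : ℝ => max (s - μ) 0 ^ 2 := by fun_prop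
  rw [← ofReal_integral_eq_lintegral_ofReal
    (hc.integrableOn_Icc.mono_set Set.Ioc_subset_Icc_self)
    (Filter.Eventually.of_forall fun μ => by positivity)] at h1
  have hs0 := (hspec s hs).1
  exact (ENNReal.ofReal_eq_ofReal_iff (integral_nonneg fun μ => by positivity)
    (by positivity)).1 h1

end SpectralCut

/-! ### From Schatten norms to L³ -/

theorem ofReal_offDiagSq_le (N : ℕ) (γ : L2 →L[ℂ] L2) :
    ENNReal.ofReal (offDiagSq N γ) ≤ ∑' n, ENNReal.ofReal (‖γ (e n)‖ ^ 2) := by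
  set I := Finset.Icc (-(N : ℤ)) N with hI
  have hsub : pairs N ⊆ I ×ˢ I := fun q hq => by
    rw [pairs, Finset.mem_offDiag] at hq
    exact Finset.mem_product.2 ⟨hq.1, hq.2.1⟩
  have h1 : offDiagSq N γ ≤ ∑ n ∈ I, ‖γ (e n)‖ ^ 2 := by
    calc offDiagSq N γ ≤ ∑ q ∈ I ×ˢ I, ‖(inner ℂ (e q.1) (γ (e q.2)) : ℂ)‖ ^ 2 :=
          Finset.sum_le_sum_of_subset_of_nonneg hsub fun _ _ _ => by positivity
      _ = ∑ n ∈ I, ∑ m ∈ I, ‖(inner ℂ (e m) (γ (e n)) : ℂ)‖ ^ 2 := Finset.sum_product_right _ _ _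
      _ ≤ ∑ n ∈ I, ‖γ (e n)‖ ^ 2 :=
          Finset.sum_le_sum fun n _ => orthonormal_e.sum_inner_products_le (γ (e n))
  refine (ENNReal.ofReal_le_ofReal h1).trans ?_
  exact (ENNReal.ofReal_sum_of_nonneg fun n _ => by positivity).trans_le (ENNReal.sum_le_tsum I)

theorem eLpNorm_three_le {F : ℝ × Circ → ℂ} {M : ℝ} (hM : 0 ≤ M)
    (h : ∫⁻ p, ENNReal.ofReal (‖F p‖ ^ 3) ∂spaceTime ≤ ENNReal.ofReal (M ^ 3)) :
    eLpNorm F 3 spaceTime ≤ ENNReal.ofReal M := by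
  rw [eLpNorm_eq_lintegral_rpow_enorm_toReal (by norm_num) (by norm_num)]
  simp only [ENNReal.toReal_ofNat]
  have h1 (p : ℝ × Circ) : ‖F p‖ₑ ^ (3 : ℝ) = ENNReal.ofReal (‖F p‖ ^ 3) := by
    rw [← ofReal_norm, ENNReal.ofReal_rpow_of_nonneg (norm_nonneg _) (by norm_num)]
    norm_cast
  simp_rw [h1]
  refine (ENNReal.rpow_le_rpow h (by norm_num)).trans_eq ?_
  rw [ENNReal.ofReal_rpow_of_nonneg (by positivity) (by norm_num), ← Real.rpow_natCast,
    ← Real.rpow_mul hM]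
  norm_num

/-- Interpolation without loss between 𝔖² → L² and the pointwise bound: the layers of |ρ̄|/N are
compared with the layers of |γ| at the same height μ, so the constants 3 and 1/3 cancel. -/
theorem lintegral_trigDensity_pow_three_le {N : ℕ} (hN : 1 ≤ N) (γ : L2 →L[ℂ] L2) :
    ∫⁻ p, ENNReal.ofReal (‖trigDensity N γ p‖ ^ 3) ∂spaceTime ≤
      ENNReal.ofReal N * absTrace e (fun s => s ^ 3) γ := by
  have hN0 : (0 : ℝ) < N := by exact_mod_cast hN
  set g : ℝ × Circ → ℝ := fun p => ‖trigDensity N γ p‖ / N with hg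
  have hgc : Continuous g := (continuous_trigDensity N γ).norm.div_const _
  have hgK (p : ℝ × Circ) : g p ≤ ‖γ‖ := by
    rw [hg, div_le_iff₀ hN0, mul_comm]
    exact norm_trigDensity_le hN γ p
  have hg0 (p : ℝ × Circ) : 0 ≤ g p := by positivity
  have h1 (p : ℝ × Circ) : ENNReal.ofReal (‖trigDensity N γ p‖ ^ 3) =
      ENNReal.ofReal (3 * N ^ 3) *
        ∫⁻ μ in Set.Ioc 0 ‖γ‖, ENNReal.ofReal (max (g p - μ) 0 ^ 2) := by
    rw [setLIntegral_sub_max_sq (hg0 p) (hgK p), ← ENNReal.ofReal_mul (by positivity)]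
    congr 1
    simp only [hg]
    field_simp
  have h2 (μ : ℝ) (hμ : μ ∈ Set.Ioc 0 ‖γ‖) :
      ∫⁻ p, ENNReal.ofReal (max (g p - μ) 0 ^ 2) ∂spaceTime ≤
        ENNReal.ofReal ((N : ℝ) ^ 2)⁻¹ * absTrace e (fun s => max (s - μ) 0 ^ 2) γ := by
    have hpt (p : ℝ × Circ) : max (g p - μ) 0 ^ 2 ≤
        ((N : ℝ) ^ 2)⁻¹ * ‖trigDensity N (highPart μ γ) p‖ ^ 2 := by
      -- The low part has operator norm at most μ, hence density at most Nμ; above that level only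
      -- the high part remains.
      have hle : ‖trigDensity N γ p‖ ≤ ‖trigDensity N (highPart μ γ) p‖ + N * μ := by
        conv_lhs => rw [← highPart_add_lowPart hμ.1 γ, trigDensity_add]
        refine (norm_add_le _ _).trans (add_le_add_right ?_ _)
        refine (norm_trigDensity_le hN _ p).trans ?_
        gcongr
        exact norm_lowPart_le hμ.1 γ
      have h3 : g p - μ ≤ ‖trigDensity N (highPart μ γ) p‖ / N := by
        rw [hg, le_div_iff₀ hN0, sub_mul, div_mul_cancel₀ _ hN0.ne']
        linarith
      calc max (g p - μ) 0 ^ 2 ≤ (‖trigDensity N (highPart μ γ) p‖ / N) ^ 2 := by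
            gcongr
            exact max_le h3 (by positivity)
        _ = ((N : ℝ) ^ 2)⁻¹ * ‖trigDensity N (highPart μ γ) p‖ ^ 2 := by
            rw [div_pow, div_eq_inv_mul]
    calc ∫⁻ p, ENNReal.ofReal (max (g p - μ) 0 ^ 2) ∂spaceTime
        ≤ ∫⁻ p, ENNReal.ofReal
            (((N : ℝ) ^ 2)⁻¹ * ‖trigDensity N (highPart μ γ) p‖ ^ 2) ∂spaceTime :=
          lintegral_mono fun p => ENNReal.ofReal_le_ofReal (hpt p)
      _ = ENNReal.ofReal (∫ p, ((N : ℝ) ^ 2)⁻¹ * ‖trigDensity N (highPart μ γ) p‖ ^ 2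
            ∂spaceTime) := by
          rw [ofReal_integral_eq_lintegral_ofReal]
          · exact integrable_of_continuous
              (continuous_const.mul ((continuous_trigDensity N _).norm.pow 2))
          · exact Filter.Eventually.of_forall fun p => by positivity
      _ ≤ ENNReal.ofReal (((N : ℝ) ^ 2)⁻¹ * offDiagSq N (highPart μ γ)) := by
          rw [integral_const_mul]
          gcongr
          exact integral_norm_sq_trigDensity_le N _
      _ ≤ ENNReal.ofReal ((N : ℝ) ^ 2)⁻¹ * absTrace e (fun s => max (s - μ) 0 ^ 2) γ := by
          rw [ENNReal.ofReal_mul (by positivity), ← tsum_norm_sq_highPart e hμ.1 γ]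
          gcongr
          exact ofReal_offDiagSq_le N _
  simp_rw [h1]
  have hmeas : Measurable (Function.uncurry fun (p : ℝ × Circ) (μ : ℝ) =>
      ENNReal.ofReal (max (g p - μ) 0 ^ 2)) := by
    have : Continuous (Function.uncurry fun (p : ℝ × Circ) (μ : ℝ) => max (g p - μ) 0 ^ 2) := by
      unfold Function.uncurry
      fun_prop
    exact this.measurable.ennreal_ofReal
  rw [lintegral_const_mul' _ _ ENNReal.ofReal_ne_top,
    lintegral_lintegral_swap hmeas.aemeasurable]
  calc ENNReal.ofReal (3 * N ^ 3) *
        ∫⁻ μ in Set.Ioc 0 ‖γ‖, ∫⁻ p, ENNReal.ofReal (max (g p - μ) 0 ^ 2) ∂spaceTime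
      ≤ ENNReal.ofReal (3 * N ^ 3) * ∫⁻ μ in Set.Ioc 0 ‖γ‖,
          ENNReal.ofReal ((N : ℝ) ^ 2)⁻¹ * absTrace e (fun s => max (s - μ) 0 ^ 2) γ := by
        exact mul_le_mul' le_rfl
          (setLIntegral_mono_ae' measurableSet_Ioc (Filter.Eventually.of_forall h2))
    _ ≤ ENNReal.ofReal (3 * N ^ 3) *
          (ENNReal.ofReal ((N : ℝ) ^ 2)⁻¹ * absTrace e (fun s => s ^ 3 / 3) γ) := by
        rw [lintegral_const_mul' _ _ ENNReal.ofReal_ne_top]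
        gcongr
        exact setLIntegral_absTrace_le e γ
    _ = ENNReal.ofReal N * absTrace e (fun s => s ^ 3) γ := by
        have h4 : (fun s : ℝ => s ^ 3 / 3) = fun s => (1 / 3) * s ^ 3 := by funext s; ring
        rw [h4, absTrace_const_mul e (by norm_num) (by fun_prop), ← mul_assoc, ← mul_assoc,
          ← ENNReal.ofReal_mul (by positivity), ← ENNReal.ofReal_mul (by positivity)]
        congr 2
        field_simp

theorem exists_eLpNorm_trigDensity_le_sqrt {ε : ℝ} (hε : 0 < ε) :
    ∃ C : ℝ, 1 ≤ C ∧ ∀ N : ℕ, 1 ≤ N → ∀ γ : L2 →L[ℂ] L2,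
      eLpNorm (trigDensity N γ) 3 spaceTime ≤
        ENNReal.ofReal (C * (N : ℝ) ^ (1 / 6 + ε) * √(offDiagSq N γ)) := by
  -- The integers counted are at most 64N², so exponent 3ε costs N^{6ε}. The square root in the
  -- third moment and then the cube root turn this into N^ε.
  obtain ⟨C₀, hC₀, hdiv⟩ := exists_card_divisors_le_rpow (ε := 3 * ε) (by positivity)
  set C₁ : ℝ := C₀ * (64 : ℝ) ^ (3 * ε) with hC₁
  have h64 : (1 : ℝ) ≤ (64 : ℝ) ^ (3 * ε) := Real.one_le_rpow (by norm_num) (by positivity)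
  have hC₁1 : 1 ≤ C₁ := one_le_mul_of_one_le_of_one_le hC₀ h64
  refine ⟨4 * √C₁, ?_, fun N hN γ => eLpNorm_three_le (by positivity) ?_⟩
  · have : 1 ≤ √C₁ := Real.one_le_sqrt.2 hC₁1
    linarith
  have hN1 : (1 : ℝ) ≤ N := by exact_mod_cast hN
  have hN0 : (0 : ℝ) < N := by linarith
  set d : ℝ := C₁ * (N : ℝ) ^ (6 * ε) with hd
  have hd1 : 1 ≤ d := one_le_mul_of_one_le_of_one_le hC₁1 (Real.one_le_rpow hN1 (by positivity))
  have hD (n : ℕ) (hn : n ≤ 64 * N ^ 2) : n.divisors.card ≤ ⌊d⌋₊ := by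
    refine Nat.le_floor ?_
    rcases eq_or_ne n 0 with rfl | h0
    · simp only [Nat.divisors_zero, Finset.card_empty, Nat.cast_zero]
      linarith
    refine (hdiv n h0).trans ?_
    rw [hd, hC₁, mul_assoc]
    refine mul_le_mul_of_nonneg_left ?_ (by linarith)
    have hn' : (n : ℝ) ≤ 64 * N ^ 2 := by exact_mod_cast hn
    calc (n : ℝ) ^ (3 * ε) ≤ (64 * (N : ℝ) ^ 2) ^ (3 * ε) := by gcongr
      _ = 64 ^ (3 * ε) * (N : ℝ) ^ (6 * ε) := by
          rw [Real.mul_rpow (by norm_num) (by positivity), ← Real.rpow_natCast,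
            ← Real.rpow_mul hN0.le]
          congr 2
          push_cast
          ring
  have hX := offDiagSq_nonneg N γ
  have hint : Integrable (fun p => ‖trigDensity N γ p‖ ^ 3) spaceTime :=
    integrable_of_continuous ((continuous_trigDensity N γ).norm.pow 3)
  rw [← ofReal_integral_eq_lintegral_ofReal hint
    (Filter.Eventually.of_forall fun p => by positivity)]
  refine ENNReal.ofReal_le_ofReal ((integral_norm_pow_three_trigDensity_le hD γ).trans ?_)
  have hfl : (⌊d⌋₊ : ℝ) ≤ d := Nat.floor_le (by linarith)
  have hs : √(1 + (4 * N + 1) * (2 * (⌊d⌋₊ : ℝ) + 1)) ≤ 4 * √C₁ * (N : ℝ) ^ (1 / 2 + 3 * ε) := by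
    rw [Real.sqrt_le_left (by positivity), mul_pow, mul_pow, Real.sq_sqrt (by linarith),
      ← Real.rpow_natCast ((N : ℝ) ^ _), ← Real.rpow_mul hN0.le]
    have h5 : (N : ℝ) ^ ((1 / 2 + 3 * ε) * (2 : ℕ)) = N * (N : ℝ) ^ (6 * ε) := by
      nth_rw 2 [← Real.rpow_one (N : ℝ)]
      rw [← Real.rpow_add hN0]
      congr 1
      push_cast
      ring
    rw [h5]
    have h6 : (4 * (N : ℝ) + 1) * (2 * (⌊d⌋₊ : ℝ) + 1) ≤ (5 * N) * (3 * d) := by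
      gcongr <;> linarith
    have h7 : 1 ≤ N * d := one_le_mul_of_one_le_of_one_le hN1 hd1
    calc 1 + (4 * (N : ℝ) + 1) * (2 * (⌊d⌋₊ : ℝ) + 1) ≤ 16 * (N * d) := by linarith
      _ = 4 ^ 2 * C₁ * (N * (N : ℝ) ^ (6 * ε)) := by rw [hd]; ring
  have hX3 : offDiagSq N γ ^ (3 / 2 : ℝ) = √(offDiagSq N γ) ^ 3 := by
    rw [Real.sqrt_eq_rpow, ← Real.rpow_natCast, ← Real.rpow_mul hX]
    norm_num
  have hN3 : (N : ℝ) ^ (1 / 2 + 3 * ε) = ((N : ℝ) ^ (1 / 6 + ε)) ^ 3 := by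
    rw [← Real.rpow_natCast, ← Real.rpow_mul hN0.le]
    congr 1
    push_cast
    ring
  rw [hX3, mul_pow, mul_pow, ← hN3]
  refine mul_le_mul_of_nonneg_right (hs.trans ?_) (by positivity)
  refine mul_le_mul_of_nonneg_right ?_ (by positivity)
  have : 1 ≤ √C₁ := Real.one_le_sqrt.2 hC₁1
  exact le_self_pow₀ (by linarith) (by norm_num)

/-- The left side vanishes unless s > μ, where s^{2-α} ≤ μ^{2-α} because 2 - α ≤ 0. This and the
next inequality, applied to |γ|, control both pieces of a cut by Tr |γ|^α. -/
theorem sub_max_sq_le {α μ s : ℝ} (hα : 2 ≤ α) (hμ : 0 < μ) (hs : 0 ≤ s) :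
    max (s - μ) 0 ^ 2 ≤ μ ^ (2 - α) * s ^ α := by
  rcases le_total s μ with h | h
  · rw [max_eq_right (by linarith)]
    have : 0 ≤ μ ^ (2 - α) * s ^ α := by positivity
    simpa using this
  · have hs0 : 0 < s := hμ.trans_le h
    rw [max_eq_left (by linarith)]
    calc (s - μ) ^ 2 ≤ s ^ 2 := by gcongr; linarith
      _ = s ^ (2 - α) * s ^ α := by
          rw [← Real.rpow_add hs0, sub_add_cancel, Real.rpow_two]
      _ ≤ μ ^ (2 - α) * s ^ α := by
          refine mul_le_mul_of_nonneg_right ?_ (by positivity)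
          exact Real.rpow_le_rpow_of_nonpos hμ h (by linarith)

theorem min_pow_three_le {α μ s : ℝ} (hα : 2 ≤ α) (hα3 : α ≤ 3) (hμ : 0 < μ) (hs : 0 ≤ s) :
    min s μ ^ 3 ≤ μ ^ (3 - α) * s ^ α := by
  rcases hs.eq_or_lt with rfl | hs0
  · rw [min_eq_left hμ.le, Real.zero_rpow (by linarith)]
    simp
  have hm : 0 < min s μ := lt_min hs0 hμ
  calc min s μ ^ 3 = min s μ ^ (3 - α) * min s μ ^ α := by
        rw [← Real.rpow_add hm, sub_add_cancel]; norm_cast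
    _ ≤ μ ^ (3 - α) * s ^ α := by
        gcongr
        · exact min_le_right _ _
        · exact min_le_left _ _

/-- Here S = Tr |γ|^α. A cut at height μ bounds the squared Hilbert–Schmidt norm of the high part by
μ^{2-α}S and the cubed 𝔖³ norm of the low part by μ^{3-α}S. -/
theorem exists_eLpNorm_trigDensity_le {α ε : ℝ} (hα : 2 ≤ α) (hα3 : α ≤ 3) (hε : 0 < ε) :
    ∃ C : ℝ, 0 < C ∧ ∀ N : ℕ, 1 ≤ N → ∀ γ : L2 →L[ℂ] L2, schattenNorm α γ < ∞ →
      eLpNorm (trigDensity N γ) 3 spaceTime ≤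
        ENNReal.ofReal (C * (N : ℝ) ^ (2 / 3 - 1 / α + ε)) * schattenNorm α γ := by
  obtain ⟨C, hC, hbd⟩ := exists_eLpNorm_trigDensity_le_sqrt hε
  refine ⟨C + 1, by linarith, fun N hN γ hfin => ?_⟩
  have hN1 : (1 : ℝ) ≤ N := by exact_mod_cast hN
  have hN0 : (0 : ℝ) < N := by linarith
  have hα0 : 0 < α := by linarith
  have hcα : Continuous fun s : ℝ => s ^ α := Real.continuous_rpow_const hα0.le
  have hb : (eBasis : ℤ → L2) = e := by rw [eBasis, HilbertBasis.coe_mk]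
  have hsch : schattenNorm α γ = absTrace e (fun s => s ^ α) γ ^ (1 / α) := by
    rw [schattenNorm, schattenNormOf_eq, hb]
  have hST : absTrace e (fun s => s ^ α) γ ≠ ∞ := by
    intro h
    rw [hsch, h, ENNReal.top_rpow_of_pos (by positivity)] at hfin
    exact hfin.ne rfl
  obtain ⟨S, hS0, hS⟩ : ∃ S : ℝ, 0 ≤ S ∧ absTrace e (fun s => s ^ α) γ = ENNReal.ofReal S :=
    ⟨_, ENNReal.toReal_nonneg, (ENNReal.ofReal_toReal hST).symm⟩
  rw [hsch, hS, ENNReal.ofReal_rpow_of_nonneg hS0 (by positivity),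
    ← ENNReal.ofReal_mul (by positivity)]
  have hsplit (μ : ℝ) (hμ : 0 < μ) : eLpNorm (trigDensity N γ) 3 spaceTime ≤
      ENNReal.ofReal (C * (N : ℝ) ^ (1 / 6 + ε) * √(μ ^ (2 - α) * S) +
        ((N : ℝ) * (μ ^ (3 - α) * S)) ^ (1 / 3 : ℝ)) := by
    have hsum : trigDensity N γ = trigDensity N (highPart μ γ) + trigDensity N (lowPart μ γ) := by
      funext p
      rw [Pi.add_apply, ← trigDensity_add, highPart_add_lowPart hμ]
    rw [ENNReal.ofReal_add (by positivity) (by positivity), hsum]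
    refine (eLpNorm_add_le (continuous_trigDensity _ _).aestronglyMeasurable
      (continuous_trigDensity _ _).aestronglyMeasurable (by norm_num)).trans (add_le_add ?_ ?_)
    · refine (hbd N hN _).trans (ENNReal.ofReal_le_ofReal ?_)
      gcongr
      rw [← ENNReal.ofReal_le_ofReal_iff (by positivity), ENNReal.ofReal_mul (by positivity), ← hS,
        ← absTrace_const_mul e (by positivity) hcα]
      refine (ofReal_offDiagSq_le N _).trans ?_
      rw [tsum_norm_sq_highPart e hμ γ]
      exact absTrace_mono e (by fun_prop) (continuous_const.mul hcα)
        (fun s hs => sub_max_sq_le hα hμ hs) γ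
    · refine eLpNorm_three_le (by positivity) ?_
      rw [← Real.rpow_natCast, ← Real.rpow_mul (by positivity)]
      norm_num only [Real.rpow_one]
      refine (lintegral_trigDensity_pow_three_le hN _).trans ?_
      rw [ENNReal.ofReal_mul hN0.le]
      gcongr
      rw [ENNReal.ofReal_mul (by positivity), ← hS, ← absTrace_const_mul e (by positivity) hcα,
        absTrace_lowPart e hμ (by fun_prop)]
      exact absTrace_mono e (by fun_prop) (continuous_const.mul hcα)
        (fun s hs => min_pow_three_le hα hα3 hμ hs) γ
  -- For S = 0 the balanced height would be zero, so any positive height is taken.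
  rcases hS0.eq_or_lt with rfl | hSpos
  · refine (hsplit 1 one_pos).trans (ENNReal.ofReal_le_ofReal ?_)
    simp only [mul_zero, Real.sqrt_zero, zero_add]
    rw [Real.zero_rpow (by norm_num)]
    positivity
  -- At N μ^α = S both terms scale as N^{2/3-1/α} S^{1/α}, up to N^ε in the first. With x = log S
  -- and y = log N this becomes linear arithmetic in exponents.
  refine (hsplit ((S / N) ^ (1 / α)) (by positivity)).trans (ENNReal.ofReal_le_ofReal ?_)
  have hy0 : 0 ≤ Real.log N := Real.log_nonneg hN1
  have hNexp : (N : ℝ) = Real.exp (Real.log N) := (Real.exp_log hN0).symm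
  have hSexp : S = Real.exp (Real.log S) := (Real.exp_log hSpos).symm
  have hr (u v : ℝ) : Real.exp u ^ v = Real.exp (u * v) := (Real.exp_mul u v).symm
  set x := Real.log S
  set y := Real.log N
  rw [hNexp, hSexp, add_mul, add_mul, one_mul, mul_assoc C, mul_assoc C, Real.sqrt_eq_rpow]
  simp only [← Real.exp_sub, ← Real.exp_add, hr]
  refine add_le_add (mul_le_mul_of_nonneg_left (Real.exp_le_exp.2 (le_of_eq ?_)) (by linarith))
    (Real.exp_le_exp.2 ?_)
  · field_simp
    ring
  · have : (y + ((x - y) * (1 / α) * (3 - α) + x)) * (1 / 3) =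
        y * (2 / 3 - 1 / α) + x * (1 / α) := by
      field_simp
      ring
    rw [this]
    nlinarith

theorem eLpNorm_trigDensity_le_schattenNorm_three {N : ℕ} (hN : 1 ≤ N) (γ : L2 →L[ℂ] L2)
    (hfin : schattenNorm 3 γ < ∞) :
    eLpNorm (trigDensity N γ) 3 spaceTime ≤
      ENNReal.ofReal ((N : ℝ) ^ (1 / 3 : ℝ)) * schattenNorm 3 γ := by
  have hb : (eBasis : ℤ → L2) = e := by rw [eBasis, HilbertBasis.coe_mk]
  have hsch : schattenNorm 3 γ = absTrace e (fun s => s ^ 3) γ ^ (1 / 3 : ℝ) := by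
    rw [schattenNorm, schattenNormOf_eq, hb]
    norm_cast
  have hST : absTrace e (fun s => s ^ 3) γ ≠ ∞ := by
    intro h
    rw [hsch, h, ENNReal.top_rpow_of_pos (by positivity)] at hfin
    exact hfin.ne rfl
  obtain ⟨S, hS0, hS⟩ : ∃ S : ℝ, 0 ≤ S ∧ absTrace e (fun s => s ^ 3) γ = ENNReal.ofReal S :=
    ⟨_, ENNReal.toReal_nonneg, (ENNReal.ofReal_toReal hST).symm⟩
  rw [hsch, hS, ENNReal.ofReal_rpow_of_nonneg hS0 (by positivity),
    ← ENNReal.ofReal_mul (by positivity), ← Real.mul_rpow (by positivity) hS0]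
  refine eLpNorm_three_le (by positivity) ?_
  rw [← Real.rpow_natCast, ← Real.rpow_mul (by positivity)]
  norm_num only [Real.rpow_one]
  rw [ENNReal.ofReal_mul (by positivity), ← hS]
  exact lintegral_trigDensity_pow_three_le hN γ

/-! ### Singular value decompositions and the density they define -/

section SingularValueDecomposition

variable {E : Type*} [NormedAddCommGroup E] [InnerProductSpace ℂ E] [FiniteDimensional ℂ E]

theorem exists_orthonormalBasis_singularValues (T : E →ₗ[ℂ] E) {d : ℕ}
    (hd : Module.finrank ℂ E = d) :
    ∃ v w : OrthonormalBasis (Fin d) ℂ E, ∀ i : Fin d, T (v i) = (T.singularValues i : ℂ) • w i := by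
  set v := T.isSymmetric_adjoint_comp_self.eigenvectorBasis hd with hv
  set σ : Fin d → ℝ := fun i => T.singularValues i with hσ
  have hinner (i j : Fin d) : inner ℂ (T (v i)) (T (v j)) = if i = j then (σ i : ℂ) ^ 2 else 0 := by
    have h1 := T.isSymmetric_adjoint_comp_self.apply_eigenvectorBasis hd j
    rw [← hv, LinearMap.comp_apply, ← T.sq_singularValues_fin hd j] at h1
    rw [← LinearMap.adjoint_inner_right, h1, inner_smul_right,
      orthonormal_iff_ite.1 v.orthonormal i j]
    split_ifs with h
    · subst h
      simp [hσ]
    · simp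
  -- The images of eigenvectors of T*T with nonzero singular value are orthogonal; once normalised
  -- they extend to a basis, and T kills the other eigenvectors.
  have hw : Orthonormal ℂ (Set.domRestrict {i | σ i ≠ 0} fun i => (σ i : ℂ)⁻¹ • T (v i)) := by
    rw [orthonormal_iff_ite]
    rintro ⟨i, hi⟩ ⟨j, hj⟩
    have hi' : (σ i : ℂ) ≠ 0 := Complex.ofReal_ne_zero.2 hi
    simp only [Set.domRestrict_apply, inner_smul_left, inner_smul_right, hinner, Subtype.mk.injEq,
      map_inv₀, Complex.conj_ofReal]
    split_ifs with h
    · subst h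
      field_simp
    · simp
  obtain ⟨w, hw⟩ := hw.exists_orthonormalBasis_extension_of_card_eq (by simpa using hd)
  refine ⟨v, w, fun i => ?_⟩
  by_cases hi : σ i = 0
  · have h1 := hinner i i
    rw [if_pos rfl, hi, Complex.ofReal_zero, zero_pow two_ne_zero, inner_self_eq_zero] at h1
    rw [h1]
    change 0 = (σ i : ℂ) • w i
    rw [hi, Complex.ofReal_zero, zero_smul]
  · rw [hw i hi]
    change _ = (σ i : ℂ) • _
    rw [smul_inv_smul₀ (Complex.ofReal_ne_zero.2 hi)]

end SingularValueDecomposition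

/-- The trigonometric polynomials of degree at most `N`. -/
noncomputable def trigSpan (N : ℕ) : Submodule ℂ L2 :=
  Submodule.span ℂ (e '' (Finset.Icc (-(N : ℤ)) N : Set ℤ))

theorem e_mem_trigSpan {N : ℕ} {k : ℤ} (hk : k ∈ Finset.Icc (-(N : ℤ)) N) : e k ∈ trigSpan N :=
  Submodule.subset_span ⟨k, hk, rfl⟩

theorem inner_e_eq_zero_of_mem_trigSpan {N : ℕ} {k : ℤ} (hk : k ∉ Finset.Icc (-(N : ℤ)) N) {f : L2}
    (hf : f ∈ trigSpan N) : inner ℂ f (e k) = 0 := by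
  induction hf using Submodule.span_induction with
  | mem x hx =>
    obtain ⟨m, hm, rfl⟩ := hx
    exact orthonormal_e.2 fun h => hk (h ▸ hm)
  | zero => simp
  | add x y _ _ hx hy => rw [inner_add_left, hx, hy, add_zero]
  | smul c x _ hx => rw [inner_smul_left, hx, mul_zero]

instance finiteDimensional_trigSpan (N : ℕ) : FiniteDimensional ℂ (trigSpan N) :=
  FiniteDimensional.span_of_finite ℂ ((Finset.finite_toSet _).image _)

theorem clm_ext_e {A B : L2 →L[ℂ] L2} (h : ∀ k, A (e k) = B (e k)) : A = B := by
  refine ContinuousLinearMap.ext_on (s := Set.range e)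
    (Submodule.dense_iff_topologicalClosure_eq_top.2 (top_le_iff.1 span_e_dense)) ?_
  rintro _ ⟨k, rfl⟩
  exact h k

theorem exists_isSVD {N : ℕ} {A : L2 →L[ℂ] L2} (hA : ∀ f, A f ∈ trigSpan N)
    (hA0 : ∀ k, k ∉ Finset.Icc (-(N : ℤ)) N → A (e k) = 0) :
    ∃ s : (ℕ → ℝ) × (ℕ → L2) × (ℕ → L2), IsSVD A s.1 s.2.1 s.2.2 := by
  set V := trigSpan N with hV
  set d := Module.finrank ℂ V with hd
  set T : V →ₗ[ℂ] V := ((A : L2 →ₗ[ℂ] L2).domRestrict V).codRestrict V fun f => hA f with hT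
  obtain ⟨v, w, hvw⟩ := exists_orthonormalBasis_singularValues T hd.symm
  have hAv (i : Fin d) : A (v i) = (T.singularValues i : ℂ) • (w i : L2) := by
    exact congrArg Subtype.val (hvw i)
  -- `IsSVD` requires infinite orthonormal sequences. The padding uses frequencies above N,
  -- orthogonal to `trigSpan N`, with singular value zero.
  let ext (u : OrthonormalBasis (Fin d) ℂ V) (n : ℕ) : L2 :=
    if h : n < d then (u ⟨n, h⟩ : L2) else e (n + N + 1)
  have hnot (n : ℕ) : ((n : ℤ) + N + 1) ∉ Finset.Icc (-(N : ℤ)) N := by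
    rw [Finset.mem_Icc]; omega
  have hext (u : OrthonormalBasis (Fin d) ℂ V) : Orthonormal ℂ (ext u) := by
    rw [orthonormal_iff_ite]
    intro i j
    simp only [ext]
    split_ifs with hi hj hij hij hj hij hij
    · subst hij
      exact (orthonormal_iff_ite.1 u.orthonormal ⟨i, hi⟩ ⟨i, hi⟩).trans (if_pos rfl)
    · exact (orthonormal_iff_ite.1 u.orthonormal ⟨i, hi⟩ ⟨j, hj⟩).trans
        (if_neg (by simpa using hij))
    · omega
    · exact inner_e_eq_zero_of_mem_trigSpan (hnot j) (u ⟨i, hi⟩).2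
    · omega
    · rw [← inner_conj_symm, inner_e_eq_zero_of_mem_trigSpan (hnot i) (u ⟨j, hj⟩).2, map_zero]
    · subst hij
      exact (orthonormal_iff_ite.1 orthonormal_e _ _).trans (if_pos rfl)
    · exact orthonormal_e.2 (by omega)
  refine ⟨(T.singularValues, ext w, ext v), T.singularValues_antitone, T.singularValues_nonneg,
    hext w, hext v, ?_⟩
  have hsum : A = ∑ n ∈ Finset.range d,
      (T.singularValues n : ℂ) • InnerProductSpace.rankOne ℂ (ext w n) (ext v n) := by
    rw [Finset.sum_range]
    have hextlt (u : OrthonormalBasis (Fin d) ℂ V) (i : Fin d) : ext u i = (u i : L2) := by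
      simp [ext]
    simp_rw [hextlt]
    refine clm_ext_e fun k => ?_
    rw [sum_apply]
    simp only [smul_apply, InnerProductSpace.rankOne_apply]
    by_cases hk : k ∈ Finset.Icc (-(N : ℤ)) N
    · have h1 := v.sum_repr' ⟨e k, e_mem_trigSpan hk⟩
      have h2 := congrArg Subtype.val h1
      simp only [Submodule.coe_sum, Submodule.coe_smul, Submodule.coe_inner] at h2
      conv_lhs => rw [← h2, map_sum]
      refine Finset.sum_congr rfl fun i _ => ?_
      rw [map_smul, hAv, smul_comm]
    · rw [hA0 k hk]
      refine (Finset.sum_eq_zero fun i _ => ?_).symm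
      rw [inner_e_eq_zero_of_mem_trigSpan hk (v i).2, zero_smul, smul_zero]
  have hs : HasSum (fun n => (T.singularValues n : ℂ) •
      InnerProductSpace.rankOne ℂ (ext w n) (ext v n)) _ :=
    hasSum_sum_of_ne_finset_zero (s := Finset.range d) fun n hn => by
      rw [T.singularValues_of_finrank_le (by simpa using hn), Complex.ofReal_zero, zero_smul]
  rw [← hsum] at hs
  exact hs

/-- The continuous function `e_n`. -/
noncomputable def eFun (n : ℤ) : C(Circ, ℂ) := ((√(2 * π))⁻¹ : ℂ) • (fourier n : C(Circ, ℂ))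

theorem coeFn_sum_smul_e (I : Finset ℤ) (c : ℤ → ℂ) :
    ((∑ k ∈ I, c k • e k : L2) : Circ → ℂ) =ᵐ[volume] fun x => ∑ k ∈ I, c k * eFun k x := by
  have h : (∑ k ∈ I, c k • e k : L2) = ContinuousMap.toLp (E := ℂ) 2 (volume : Measure Circ) ℂ
      (∑ k ∈ I, c k • eFun k) := by
    rw [map_sum]
    simp_rw [map_smul]
    rfl
  rw [h]
  refine (ContinuousMap.coeFn_toLp _ _).trans (Filter.Eventually.of_forall fun x => ?_)
  simp

theorem eq_sum_inner_smul_e {I : Finset ℤ} {f : L2} (hf : ∀ k ∉ I, inner ℂ (e k) f = 0) :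
    f = ∑ k ∈ I, (inner ℂ (e k) f : ℂ) • e k := by
  have h := eBasis.hasSum_repr f
  simp_rw [HilbertBasis.repr_apply_apply, eBasis, HilbertBasis.coe_mk] at h
  exact h.unique (hasSum_sum_of_ne_finset_zero fun k hk => by rw [hf k hk, zero_smul])

theorem IsSVD.apply_right {A : L2 →L[ℂ] L2} {a : ℕ → ℝ} {φ ψ : ℕ → L2} (h : IsSVD A a φ ψ) (n : ℕ) :
    A (ψ n) = (a n : ℂ) • φ n := by
  have h1 := h.hasSum.mapL (ContinuousLinearMap.apply ℂ L2 (ψ n))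
  refine h1.unique ?_
  convert hasSum_single n ?_ using 1
  · change (a n : ℂ) • φ n = (a n : ℂ) • ((inner ℂ (ψ n) (ψ n) : ℂ) • φ n)
    rw [orthonormal_iff_ite.1 h.orthonormal_right n n, if_pos rfl, one_smul]
  · intro m hm
    simp [InnerProductSpace.rankOne_apply, h.orthonormal_right.2 hm]

theorem IsSVD.inner_left {A : L2 →L[ℂ] L2} {a : ℕ → ℝ} {φ ψ : ℕ → L2} (h : IsSVD A a φ ψ) (n : ℕ)
    (f : L2) : inner ℂ (φ n) (A f) = (a n : ℂ) * inner ℂ (ψ n) f := by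
  have h1 := h.hasSum.mapL ((innerSL ℂ (φ n)) ∘L (ContinuousLinearMap.apply ℂ L2 f))
  refine h1.unique ?_
  convert hasSum_single n ?_ using 1
  · simp [InnerProductSpace.rankOne_apply, h.orthonormal_left.1 n]
  · intro m hm
    simp [InnerProductSpace.rankOne_apply, h.orthonormal_left.2 hm.symm]

/-- The right side depends only on A, so the choice of decomposition is immaterial. Singular vectors
with nonzero singular value are trigonometric polynomials with frequencies in I, and expanding them
turns the series into the matrix of A. -/
theorem IsSVD.density_ae {A : L2 →L[ℂ] L2} {a : ℕ → ℝ} {φ ψ : ℕ → L2} (h : IsSVD A a φ ψ)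
    {I : Finset ℤ} (hA : ∀ f, ∀ k ∉ I, inner ℂ (e k) (A f) = 0) (hA0 : ∀ k ∉ I, A (e k) = 0) :
    (fun x => ∑' n, (a n : ℂ) * (φ n : Circ → ℂ) x * conj ((ψ n : Circ → ℂ) x)) =ᵐ[volume]
      fun x => ∑ m ∈ I, ∑ k ∈ I, inner ℂ (e m) (A (e k)) * eFun m x * conj (eFun k x) := by
  have hφ (n : ℕ) (hn : a n ≠ 0) (k : ℤ) (hk : k ∉ I) : inner ℂ (e k) (φ n) = 0 := by
    have h1 := hA (ψ n) k hk
    rw [h.apply_right, inner_smul_right] at h1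
    exact (mul_eq_zero.1 h1).resolve_left (Complex.ofReal_ne_zero.2 hn)
  have hψ (n : ℕ) (hn : a n ≠ 0) (k : ℤ) (hk : k ∉ I) : inner ℂ (e k) (ψ n) = 0 := by
    have h1 := h.inner_left n (e k)
    rw [hA0 k hk, inner_zero_right] at h1
    have h2 := (mul_eq_zero.1 h1.symm).resolve_left (Complex.ofReal_ne_zero.2 hn)
    rw [← inner_conj_symm, h2, map_zero]
  -- Since a is antitone, a n ≠ 0 would put n + 1 orthonormal vectors φ_0, …, φ_n in a space of
  -- dimension |I|; summing |⟨φ_j, e_k⟩|² in both orders forbids this.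
  have hfin (n : ℕ) (hn : I.card ≤ n) : a n = 0 := by
    by_contra hne
    have hj (j : ℕ) (hj : j ∈ Finset.range (n + 1)) : a j ≠ 0 := by
      have h1 : a n ≤ a j := h.antitone (by simpa [Nat.lt_succ_iff] using hj)
      have h2 : 0 < a n := lt_of_le_of_ne (h.nonneg n) (Ne.symm hne)
      exact (h2.trans_le h1).ne'
    have hone (j : ℕ) (hj' : a j ≠ 0) : ∑ k ∈ I, ‖(inner ℂ (φ j) (e k) : ℂ)‖ ^ 2 = 1 := by
      have h1 := Orthonormal.inner_sum orthonormal_e (fun k => inner ℂ (e k) (φ j))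
        (fun k => inner ℂ (e k) (φ j)) I
      rw [← eq_sum_inner_smul_e (hφ j hj'), inner_self_eq_norm_sq_to_K, h.orthonormal_left.1 j] at h1
      simp only [Complex.conj_mul'] at h1
      simp_rw [norm_inner_symm (φ j)]
      have h2 : ((∑ k ∈ I, ‖(inner ℂ (e k) (φ j) : ℂ)‖ ^ 2 : ℝ) : ℂ) = ((1 : ℝ) : ℂ) := by
        push_cast
        rw [← h1]
        simp
      exact_mod_cast h2
    have hcount : ((n + 1 : ℕ) : ℝ) ≤ I.card := by
      calc ((n + 1 : ℕ) : ℝ) = ∑ j ∈ Finset.range (n + 1), (1 : ℝ) := by simp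
        _ = ∑ j ∈ Finset.range (n + 1), ∑ k ∈ I, ‖(inner ℂ (φ j) (e k) : ℂ)‖ ^ 2 :=
            Finset.sum_congr rfl fun j hj' => (hone j (hj j hj')).symm
        _ = ∑ k ∈ I, ∑ j ∈ Finset.range (n + 1), ‖(inner ℂ (φ j) (e k) : ℂ)‖ ^ 2 :=
            Finset.sum_comm
        _ ≤ ∑ k ∈ I, (1 : ℝ) := by
            refine Finset.sum_le_sum fun k _ =>
              (h.orthonormal_left.sum_inner_products_le (e k)).trans_eq ?_
            rw [orthonormal_e.1 k, one_pow]
        _ = I.card := by simp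
    have : n + 1 ≤ I.card := by exact_mod_cast hcount
    omega
  set d := I.card with hd
  have hcoef (m k : ℤ) : inner ℂ (e m) (A (e k)) = ∑ n ∈ Finset.range d,
      (a n : ℂ) * inner ℂ (e m) (φ n) * conj (inner ℂ (e k) (ψ n)) := by
    have h1 := h.hasSum.mapL ((innerSL ℂ (e m)) ∘L (ContinuousLinearMap.apply ℂ L2 (e k)))
    refine (h1.unique (hasSum_sum_of_ne_finset_zero (s := Finset.range d) fun n hn => ?_)).trans
      (Finset.sum_congr rfl fun n _ => ?_)
    · simp [hfin n (by simpa using hn)]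
    · simp [InnerProductSpace.rankOne_apply]
      ring
  have hae : ∀ n : ℕ, ∀ᵐ x : Circ, a n ≠ 0 →
      (φ n : Circ → ℂ) x = ∑ m ∈ I, inner ℂ (e m) (φ n) * eFun m x ∧
      (ψ n : Circ → ℂ) x = ∑ k ∈ I, inner ℂ (e k) (ψ n) * eFun k x := by
    intro n
    by_cases hn : a n = 0
    · simp [hn]
    · have h1 := coeFn_sum_smul_e I (fun k => inner ℂ (e k) (φ n))
      have h2 := coeFn_sum_smul_e I (fun k => inner ℂ (e k) (ψ n))
      rw [← eq_sum_inner_smul_e (hφ n hn)] at h1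
      rw [← eq_sum_inner_smul_e (hψ n hn)] at h2
      filter_upwards [h1, h2] with x hx1 hx2 _ using ⟨hx1, hx2⟩
  filter_upwards [ae_all_iff.2 hae] with x hx
  rw [tsum_eq_sum (s := Finset.range d) fun n hn => by simp [hfin n (by simpa using hn)]]
  simp_rw [hcoef, Finset.sum_mul]
  refine Eq.trans ?_ ((Finset.sum_congr rfl fun m _ => Finset.sum_comm).trans Finset.sum_comm).symm
  refine Finset.sum_congr rfl fun n _ => ?_
  by_cases hn : a n = 0
  · simp [hn]
  · rw [(hx n hn).1, (hx n hn).2, map_sum, mul_assoc, Finset.sum_mul_sum, Finset.mul_sum]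
    refine Finset.sum_congr rfl fun m _ => ?_
    rw [Finset.mul_sum]
    refine Finset.sum_congr rfl fun k _ => ?_
    rw [map_mul]
    ring

/-! ### The evolved operator and its trigonometric representative -/

theorem U_e (t : ℝ) (n : ℤ) : U t (e n) = phase t n • e n := by
  refine (hasSum_U t (e n)).unique ?_
  convert hasSum_single n fun m hm => ?_ using 1
  · rw [orthonormal_iff_ite.1 orthonormal_e n n, if_pos rfl, mul_one]
  · rw [orthonormal_e.2 hm, mul_zero, zero_smul]

theorem adjoint_U_e (t : ℝ) (n : ℤ) :
    ContinuousLinearMap.adjoint (U t) (e n) = conj (phase t n) • e n := by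
  have h (k : ℤ) : inner ℂ (e k) (ContinuousLinearMap.adjoint (U t) (e n)) =
      if k = n then conj (phase t n) else 0 := by
    rw [ContinuousLinearMap.adjoint_inner_right, U_e, inner_smul_left,
      orthonormal_iff_ite.1 orthonormal_e]
    split_ifs with hk
    · rw [hk, mul_one]
    · rw [mul_zero]
  have h1 := eq_sum_inner_smul_e (I := {n}) (f := ContinuousLinearMap.adjoint (U t) (e n))
    fun k hk => by rw [h, if_neg (by simpa using hk)]
  rw [Finset.sum_singleton, h, if_pos rfl] at h1
  exact h1

theorem P_apply (N : ℕ) (f : L2) :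
    P N f = ∑ n ∈ Finset.Icc (-(N : ℤ)) N, (inner ℂ (e n) f : ℂ) • e n := by
  rw [P, sum_apply]
  rfl

theorem inner_e_P (N : ℕ) {k : ℤ} (hk : k ∈ Finset.Icc (-(N : ℤ)) N) (f : L2) :
    inner ℂ (e k) (P N f) = inner ℂ (e k) f := by
  rw [P_apply, inner_sum, Finset.sum_eq_single_of_mem k hk]
  · rw [inner_smul_right, orthonormal_iff_ite.1 orthonormal_e, if_pos rfl, mul_one]
  · intro m _ hm
    rw [inner_smul_right, orthonormal_e.2 hm.symm, mul_zero]

theorem P_e_of_mem (N : ℕ) {k : ℤ} (hk : k ∈ Finset.Icc (-(N : ℤ)) N) : P N (e k) = e k := by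
  rw [P_apply, Finset.sum_eq_single_of_mem k hk]
  · rw [orthonormal_iff_ite.1 orthonormal_e, if_pos rfl, one_smul]
  · intro m _ hm
    rw [orthonormal_e.2 hm, zero_smul]

theorem P_e_of_notMem (N : ℕ) {k : ℤ} (hk : k ∉ Finset.Icc (-(N : ℤ)) N) : P N (e k) = 0 := by
  rw [P_apply]
  refine Finset.sum_eq_zero fun m hm => ?_
  have hmk : m ≠ k := fun h => hk (h ▸ hm)
  rw [orthonormal_e.2 hmk, zero_smul]

/-- The operator `U(t) P_{≤N} γ P_{≤N} U(t)*`. -/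
noncomputable def evolved (N : ℕ) (γ : L2 →L[ℂ] L2) (t : ℝ) : L2 →L[ℂ] L2 :=
  U t ∘L P N ∘L γ ∘L P N ∘L ContinuousLinearMap.adjoint (U t)

theorem evolved_apply_mem (N : ℕ) (γ : L2 →L[ℂ] L2) (t : ℝ) (f : L2) :
    evolved N γ t f ∈ trigSpan N := by
  change U t (P N (γ (P N (ContinuousLinearMap.adjoint (U t) f)))) ∈ trigSpan N
  rw [P_apply, map_sum]
  refine Submodule.sum_mem _ fun k hk => ?_
  rw [map_smul, U_e]
  exact Submodule.smul_mem _ _ (Submodule.smul_mem _ _ (e_mem_trigSpan hk))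

theorem evolved_e_of_notMem (N : ℕ) (γ : L2 →L[ℂ] L2) (t : ℝ) {k : ℤ}
    (hk : k ∉ Finset.Icc (-(N : ℤ)) N) : evolved N γ t (e k) = 0 := by
  change U t (P N (γ (P N (ContinuousLinearMap.adjoint (U t) (e k))))) = 0
  rw [adjoint_U_e, map_smul, P_e_of_notMem N hk, smul_zero, map_zero, map_zero, map_zero]

theorem inner_evolved (N : ℕ) (γ : L2 →L[ℂ] L2) (t : ℝ) {m k : ℤ}
    (hm : m ∈ Finset.Icc (-(N : ℤ)) N) (hk : k ∈ Finset.Icc (-(N : ℤ)) N) :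
    inner ℂ (e m) (evolved N γ t (e k)) =
      phase t m * conj (phase t k) * inner ℂ (e m) (γ (e k)) := by
  change inner ℂ (e m) (U t (P N (γ (P N (ContinuousLinearMap.adjoint (U t) (e k)))))) = _
  rw [← ContinuousLinearMap.adjoint_inner_left, adjoint_U_e, adjoint_U_e, map_smul,
    P_e_of_mem N hk, map_smul, map_smul, inner_smul_left, inner_smul_right, inner_e_P N hm,
    Complex.conj_conj, mul_assoc]

theorem phase_mul_conj_mul_eFun (t : ℝ) (x : Circ) (m k : ℤ) :
    phase t m * conj (phase t k) * (eFun m x * conj (eFun k x)) =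
      ((2 * π : ℝ) : ℂ)⁻¹ * char (freq (m, k)) (t, x) := by
  have h1 : eFun m x * conj (eFun k x) =
      ((2 * π : ℝ) : ℂ)⁻¹ * ((fourier m x : ℂ) * conj (fourier k x : ℂ)) := by
    have hs : (((√(2 * π) : ℝ) : ℂ))⁻¹ * (((√(2 * π) : ℝ) : ℂ))⁻¹ = ((2 * π : ℝ) : ℂ)⁻¹ := by
      rw [← mul_inv, ← Complex.ofReal_mul, Real.mul_self_sqrt Real.two_pi_pos.le]
    simp only [eFun, ContinuousMap.smul_apply, smul_eq_mul, map_mul, map_inv₀, Complex.conj_ofReal]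
    rw [← hs]
    ring
  have h2 (n : ℤ) : phase t n * (fourier n x : ℂ) = char (n, n ^ 2) (t, x) := by
    simp [phase, char]
  have h3 : char (freq (m, k)) (t, x) =
      char (m, m ^ 2) (t, x) * conj (char (k, k ^ 2) (t, x)) := by
    rw [char_mul_conj]; rfl
  rw [h1, h3, ← h2, ← h2, map_mul]
  ring

/-- The diagonal terms sum to exactly (2π)⁻¹ times the trace, because the phases cancel there; the
rest is `trigDensity`. -/
theorem renDensityAt_ae (N : ℕ) (γ : L2 →L[ℂ] L2) (t : ℝ) :
    renDensityAt N γ t =ᵐ[volume] fun x => trigDensity N γ (t, x) := by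
  set I := Finset.Icc (-(N : ℤ)) N with hI
  have hex := exists_isSVD (evolved_apply_mem N γ t) fun k hk => evolved_e_of_notMem N γ t hk
  have hinner : ∀ f, ∀ k ∉ I, inner ℂ (e k) (evolved N γ t f) = 0 := fun f k hk => by
    rw [← inner_conj_symm, inner_e_eq_zero_of_mem_trigSpan hk (evolved_apply_mem N γ t f), map_zero]
  have hdens : density (evolved N γ t) =ᵐ[volume] fun x => ∑ m ∈ I, ∑ k ∈ I,
      inner ℂ (e m) (evolved N γ t (e k)) * eFun m x * conj (eFun k x) := by
    rw [density, dif_pos hex]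
    exact hex.choose_spec.density_ae hinner fun k hk => evolved_e_of_notMem N γ t hk
  have htrace : trace (evolved N γ t) = ∑ k ∈ I, inner ℂ (e k) (γ (e k)) := by
    rw [trace, tsum_eq_sum (s := I) fun k hk => hinner _ k hk]
    refine Finset.sum_congr rfl fun k hk => ?_
    rw [inner_evolved N γ t hk hk, Complex.mul_conj', norm_phase]
    simp
  filter_upwards [hdens] with x hx
  change density (evolved N γ t) x - (2 * π : ℂ)⁻¹ * trace (evolved N γ t) = _
  have hterm : ∀ m ∈ I, ∀ k ∈ I,
      inner ℂ (e m) (evolved N γ t (e k)) * eFun m x * conj (eFun k x) =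
        ((2 * π : ℝ) : ℂ)⁻¹ * inner ℂ (e m) (γ (e k)) * char (freq (m, k)) (t, x) := by
    intro m hm k hk
    rw [inner_evolved N γ t hm hk, mul_right_comm _ (inner ℂ (e m) (γ (e k)))]
    linear_combination (inner ℂ (e m) (γ (e k)) : ℂ) * phase_mul_conj_mul_eFun t x m k
  rw [hx, htrace, Finset.sum_congr rfl fun m hm => Finset.sum_congr rfl (hterm m hm),
    ← Finset.sum_product', ← Finset.diag_union_offDiag,
    Finset.sum_union (Finset.disjoint_diag_offDiag I), Finset.sum_diag, trigDensity, pairs,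
    Finset.mul_sum]
  have hdiag : ∀ k ∈ I, ((2 * π : ℝ) : ℂ)⁻¹ * inner ℂ (e k) (γ (e k)) * char (freq (k, k)) (t, x) =
      (2 * π : ℂ)⁻¹ * inner ℂ (e k) (γ (e k)) := by
    intro k _
    have : freq (k, k) = 0 := by simp [freq]
    rw [this, char_zero, mul_one]
    push_cast
    rfl
  rw [Finset.sum_congr rfl hdiag]
  ring

theorem represents_trigDensity (N : ℕ) (γ : L2 →L[ℂ] L2) :
    Represents (trigDensity N γ) (renDensityAt N γ) :=
  ⟨(continuous_trigDensity N γ).aestronglyMeasurable,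
    Filter.Eventually.of_forall fun t => (renDensityAt_ae N γ t).symm⟩

theorem Represents.ae_eq {F G : ℝ × Circ → ℂ} {g : ℝ → Circ → ℂ} (hF : Represents F g)
    (hG : Represents G g) : F =ᵐ[spaceTime] G := by
  -- Measurable versions make the coincidence set measurable, as is needed to pass from almost every
  -- slice to the product.
  refine hF.1.ae_eq_mk.trans (Filter.EventuallyEq.trans ?_ hG.1.ae_eq_mk.symm)
  refine (Measure.ae_prod_iff_ae_ae (measurableSet_eq_fun hF.1.stronglyMeasurable_mk.measurable
    hG.1.stronglyMeasurable_mk.measurable)).2 ?_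
  have h1 := Measure.ae_ae_of_ae_prod hF.1.ae_eq_mk
  have h2 := Measure.ae_ae_of_ae_prod hG.1.ae_eq_mk
  filter_upwards [h1, h2, hF.2, hG.2] with t ht1 ht2 ht3 ht4
  filter_upwards [ht1, ht2, ht3, ht4] with x hx1 hx2 hx3 hx4
  rw [← hx1, ← hx2, hx3, hx4]

theorem l3Estimate_iff (α σ : ℝ) : L3Estimate α σ ↔
    ∃ C : ℝ, 0 < C ∧ ∀ N : ℕ, 1 ≤ N → ∀ γ : L2 →L[ℂ] L2, schattenNorm α γ < ∞ →
      eLpNorm (trigDensity N γ) 3 spaceTime ≤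
        ENNReal.ofReal (C * (N : ℝ) ^ σ) * schattenNorm α γ := by
  constructor
  · rintro ⟨C, hC, h⟩
    exact ⟨C, hC, fun N hN γ hγ => h N hN γ hγ _ (represents_trigDensity N γ)⟩
  · rintro ⟨C, hC, h⟩
    refine ⟨C, hC, fun N hN γ hγ F hF => ?_⟩
    rw [eLpNorm_congr_ae (hF.ae_eq (represents_trigDensity N γ))]
    exact h N hN γ hγ

theorem l3Estimate_of_le {α σ : ℝ} (hα : 2 ≤ α) (hα3 : α ≤ 3) (h3 : α = 3 → 1 / 3 ≤ σ)
    (hlt : α < 3 → 2 / 3 - 1 / α < σ) : L3Estimate α σ := by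
  rw [l3Estimate_iff]
  rcases hα3.lt_or_eq with h | rfl
  · obtain ⟨C, hC, hb⟩ := exists_eLpNorm_trigDensity_le hα hα3 (sub_pos.2 (hlt h))
    refine ⟨C, hC, fun N hN γ hγ => ?_⟩
    have := hb N hN γ hγ
    rwa [add_sub_cancel] at this
  · refine ⟨1, one_pos, fun N hN γ hγ =>
      (eLpNorm_trigDensity_le_schattenNorm_three hN γ hγ).trans ?_⟩
    have hN1 : (1 : ℝ) ≤ N := by exact_mod_cast hN
    rw [one_mul]
    gcongr
    exact h3 rfl

/-! ### The shift operator and sharpness -/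

/-- The projection Q is its own positive square root, so |A| = Q; its spectrum lies in {0, 1}, where
s ↦ s^α is the identity for α ≠ 0. -/
theorem absTrace_rpow_of_partialIsometry {H ι : Type*} [NormedAddCommGroup H]
    [InnerProductSpace ℂ H] [CompleteSpace H] (u : ι → H) {A Q : H →L[ℂ] H}
    (hQ : IsStarProjection Q) (hA : star A * A = Q) {α : ℝ} (hα : α ≠ 0) :
    absTrace u (fun s => s ^ α) A = ∑' i, ENNReal.ofReal (inner ℂ (u i) (Q (u i))).re := by
  have hsa : IsSelfAdjoint Q := hQ.isSelfAdjoint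
  have habs : CFC.abs A = Q := by
    have h : CFC.abs A = CFC.sqrt (star A * A) := rfl
    rw [h, hA]
    exact CFC.sqrt_unique hQ.isIdempotentElem hQ.nonneg
  have hcfc : cfc (fun s : ℝ => s ^ α) Q = Q := by
    conv_rhs => rw [← cfc_id' ℝ Q hsa]
    refine cfc_congr fun s hs => ?_
    rcases hQ.isIdempotentElem.spectrum_subset ℝ hs with rfl | rfl
    · simp [hα]
    · simp
  unfold absTrace
  rw [habs, hcfc]

/-- The shift `e_n ↦ e_{n+1}`, restricted to `-N ≤ n < N`. -/
noncomputable def shift (N : ℕ) : L2 →L[ℂ] L2 :=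
  ∑ n ∈ Finset.Ico (-(N : ℤ)) N, InnerProductSpace.rankOne ℂ (e (n + 1)) (e n)

/-- The projection onto the span of `e_n` for `-N ≤ n < N`. -/
noncomputable def shiftSupport (N : ℕ) : L2 →L[ℂ] L2 :=
  ∑ n ∈ Finset.Ico (-(N : ℤ)) N, InnerProductSpace.rankOne ℂ (e n) (e n)

theorem sum_rankOne_apply_e (I : Finset ℤ) (f : ℤ → L2) (k : ℤ) :
    (∑ n ∈ I, InnerProductSpace.rankOne ℂ (f n) (e n)) (e k) = if k ∈ I then f k else 0 := by
  rw [sum_apply]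
  simp only [InnerProductSpace.rankOne_apply, orthonormal_iff_ite.1 orthonormal_e, ite_smul,
    one_smul, zero_smul, Finset.sum_ite_eq']

theorem shift_e (N : ℕ) (k : ℤ) :
    shift N (e k) = if k ∈ Finset.Ico (-(N : ℤ)) N then e (k + 1) else 0 :=
  sum_rankOne_apply_e _ (fun n => e (n + 1)) k

theorem shiftSupport_e (N : ℕ) (k : ℤ) :
    shiftSupport N (e k) = if k ∈ Finset.Ico (-(N : ℤ)) N then e k else 0 :=
  sum_rankOne_apply_e _ e k

theorem star_sum_rankOne (I : Finset ℤ) (f g : ℤ → L2) :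
    star (∑ n ∈ I, InnerProductSpace.rankOne ℂ (f n) (g n)) =
      ∑ n ∈ I, InnerProductSpace.rankOne ℂ (g n) (f n) := by
  rw [star_sum]
  refine Finset.sum_congr rfl fun n _ => ?_
  rw [ContinuousLinearMap.star_eq_adjoint, InnerProductSpace.adjoint_rankOne]

theorem isStarProjection_shiftSupport (N : ℕ) : IsStarProjection (shiftSupport N) := by
  refine ⟨?_, star_sum_rankOne _ _ _⟩
  refine clm_ext_e fun k => ?_
  change shiftSupport N (shiftSupport N (e k)) = _
  rw [shiftSupport_e]
  split_ifs with h
  · rw [shiftSupport_e, if_pos h]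
  · rw [map_zero]

theorem star_shift_mul_shift (N : ℕ) : star (shift N) * shift N = shiftSupport N := by
  refine clm_ext_e fun k => ?_
  change star (shift N) (shift N (e k)) = _
  rw [shift_e, shiftSupport_e]
  split_ifs with h
  · rw [shift, star_sum_rankOne, sum_apply]
    simp only [InnerProductSpace.rankOne_apply, orthonormal_iff_ite.1 orthonormal_e, ite_smul,
      one_smul, zero_smul, add_left_inj, Finset.sum_ite_eq', h, if_true]
  · rw [map_zero]

theorem schattenNorm_shift (N : ℕ) {α : ℝ} (hα : 0 < α) :
    schattenNorm α (shift N) = ENNReal.ofReal ((2 * N : ℝ) ^ (1 / α)) := by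
  have hb : (eBasis : ℤ → L2) = e := by rw [eBasis, HilbertBasis.coe_mk]
  rw [schattenNorm, schattenNormOf_eq, hb, absTrace_rpow_of_partialIsometry e
    (isStarProjection_shiftSupport N) (star_shift_mul_shift N) hα.ne',
    ← ENNReal.ofReal_rpow_of_nonneg (by positivity) (by positivity)]
  congr 1
  have h (k : ℤ) : ENNReal.ofReal (inner ℂ (e k) (shiftSupport N (e k))).re =
      if k ∈ Finset.Ico (-(N : ℤ)) N then 1 else 0 := by
    rw [shiftSupport_e]
    split_ifs
    · rw [orthonormal_iff_ite.1 orthonormal_e, if_pos rfl]; simp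
    · simp
  simp_rw [h]
  rw [tsum_eq_sum (s := Finset.Ico (-(N : ℤ)) N) fun k hk => if_neg hk, Finset.sum_ite_mem,
    Finset.inter_self, Finset.sum_const, Int.card_Ico, nsmul_one]
  have h2 : ((N : ℤ) - -(N : ℤ)).toNat = 2 * N := by omega
  rw [h2, ← ENNReal.ofReal_natCast]
  push_cast
  rfl

theorem trigDensity_shift (N : ℕ) (p : ℝ × Circ) :
    trigDensity N (shift N) p =
      ((2 * π : ℝ) : ℂ)⁻¹ * ∑ n ∈ Finset.Ico (-(N : ℤ)) N, char (1, 2 * n + 1) p := by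
  rw [trigDensity, Finset.mul_sum]
  refine (Finset.sum_of_injOn (fun n : ℤ => (n + 1, n)) ?_ ?_ ?_ ?_).symm
  · intro a _ b _ h
    exact (Prod.mk.inj h).2
  · intro n hn
    rw [Finset.mem_coe, Finset.mem_Ico] at hn
    rw [Finset.mem_coe, pairs, Finset.mem_offDiag, Finset.mem_Icc, Finset.mem_Icc]
    simp only
    omega
  · rintro ⟨m, n⟩ _ hmn
    rw [shift_e]
    split_ifs with hn
    · rw [orthonormal_e.2, mul_zero, zero_mul]
      intro h
      exact hmn ⟨n, hn, Prod.ext h.symm rfl⟩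
    · rw [inner_zero_right, mul_zero, zero_mul]
  · intro n hn
    rw [shift_e, if_pos hn, orthonormal_iff_ite.1 orthonormal_e, if_pos rfl, mul_one]
    congr 2
    simp only [freq]
    ext <;> simp only <;> ring

theorem le_norm_trigDensity_shift {N : ℕ} {p : ℝ × Circ} (h0 : 0 ≤ p.1)
    (h1 : p.1 * (2 * N) ≤ 1) : N / (2 * π) ≤ ‖trigDensity N (shift N) p‖ := by
  obtain ⟨t, x⟩ := p
  simp only at h0 h1
  rw [trigDensity_shift, norm_mul, norm_inv, Complex.norm_real,
    Real.norm_of_nonneg Real.two_pi_pos.le, div_eq_inv_mul]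
  refine mul_le_mul_of_nonneg_left ?_ (by positivity)
  have hfac : ∑ n ∈ Finset.Ico (-(N : ℤ)) N, char (1, 2 * n + 1) (t, x) =
      (∑ n ∈ Finset.Ico (-(N : ℤ)) N,
        Complex.exp (((-(t * (2 * n + 1)) : ℝ) : ℂ) * Complex.I)) * (fourier 1 x : ℂ) := by
    rw [Finset.sum_mul]
    refine Finset.sum_congr rfl fun n _ => ?_
    unfold char
    congr 2
    push_cast
    ring
  rw [hfac, norm_mul, norm_fourier_apply, mul_one]
  refine le_trans ?_ (Complex.re_le_norm _)
  rw [Complex.re_sum]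
  simp_rw [Complex.exp_ofReal_mul_I_re, Real.cos_neg]
  calc (N : ℝ) = ∑ n ∈ Finset.Ico (-(N : ℤ)) N, (1 / 2 : ℝ) := by
        rw [Finset.sum_const, Int.card_Ico, nsmul_eq_mul]
        have h2 : ((N : ℤ) - -(N : ℤ)).toNat = 2 * N := by omega
        rw [h2]
        push_cast
        ring
    _ ≤ ∑ n ∈ Finset.Ico (-(N : ℤ)) N, Real.cos (t * (2 * n + 1)) := by
        refine Finset.sum_le_sum fun n hn => ?_
        rw [Finset.mem_Ico] at hn
        have hn1 : -(N : ℝ) ≤ n := by exact_mod_cast hn.1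
        have hn2 : (n : ℝ) + 1 ≤ N := by exact_mod_cast hn.2
        -- For -N ≤ n < N one has |2n + 1| ≤ 2N, so the phase is at most 1 and each cosine at least
        -- 1/2.
        have h3 : (t * (2 * n + 1)) ^ 2 ≤ 1 := by
          rw [sq_le_one_iff_abs_le_one, abs_le]
          constructor <;> nlinarith
        have := Real.one_sub_sq_div_two_le_cos (x := t * (2 * n + 1))
        linarith

theorem le_eLpNorm_trigDensity_shift {N : ℕ} (hN : 1 ≤ N) :
    ENNReal.ofReal (N / (2 * π) * (π / N) ^ (1 / 3 : ℝ)) ≤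
      eLpNorm (trigDensity N (shift N)) 3 spaceTime := by
  have hN1 : (1 : ℝ) ≤ N := by exact_mod_cast hN
  have hN0 : (0 : ℝ) < N := by linarith
  set S : Set (ℝ × Circ) := Set.Icc (0 : ℝ) (1 / (2 * N)) ×ˢ (Set.univ : Set Circ) with hS
  have hSm : MeasurableSet S := measurableSet_Icc.prod MeasurableSet.univ
  have hle : 1 / (2 * (N : ℝ)) ≤ 2 * π := by
    rw [div_le_iff₀ (by positivity)]
    nlinarith [Real.pi_gt_three]
  -- A time interval of length 1/(2N) times the whole circle of length 2π.
  have hvol : spaceTime S = ENNReal.ofReal (π / N) := by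
    rw [spaceTime, hS, Measure.prod_prod, Measure.restrict_apply measurableSet_Icc,
      Set.inter_eq_left.2 (Set.Icc_subset_Icc_right hle), Real.volume_Icc,
      sub_zero, AddCircle.measure_univ, ← ENNReal.ofReal_mul (by positivity)]
    congr 1
    field_simp
  have h1 := eLpNorm_indicator_const (μ := spaceTime) (c := (N / (2 * π) : ℝ)) hSm
    (p := 3) (by norm_num) (by norm_num)
  rw [hvol, Real.enorm_of_nonneg (by positivity), ENNReal.toReal_ofNat,
    ENNReal.ofReal_rpow_of_nonneg (by positivity) (by norm_num),
    ← ENNReal.ofReal_mul (by positivity)] at h1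
  rw [← h1]
  refine eLpNorm_mono fun p => ?_
  by_cases hp : p ∈ S
  · rw [Set.indicator_of_mem hp, Real.norm_of_nonneg (by positivity)]
    refine le_norm_trigDensity_shift hp.1.1 ?_
    have := hp.1.2
    rwa [le_div_iff₀ (by positivity)] at this
  · rw [Set.indicator_of_notMem hp, norm_zero]
    exact norm_nonneg _

theorem not_l3Estimate {α σ : ℝ} (hα : 0 < α) (hσ : σ < 2 / 3 - 1 / α) : ¬ L3Estimate α σ := by
  rw [l3Estimate_iff]
  rintro ⟨C, hC, h⟩
  -- The gap in the exponent: the shift would force N^δ to stay bounded by K.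
  set δ : ℝ := 2 / 3 - 1 / α - σ with hδ
  have hδ0 : 0 < δ := by linarith
  set K : ℝ := C * 2 ^ (1 / α) * (2 * π) / π ^ (1 / 3 : ℝ) with hK
  have hbound (N : ℕ) (hN : 1 ≤ N) : (N : ℝ) ^ δ ≤ K := by
    have hN0 : (0 : ℝ) < N := by exact_mod_cast hN
    have hs := schattenNorm_shift N hα
    have h1 := (le_eLpNorm_trigDensity_shift hN).trans
      (h N hN (shift N) (by rw [hs]; exact ENNReal.ofReal_lt_top))
    rw [hs, ← ENNReal.ofReal_mul (by positivity), ENNReal.ofReal_le_ofReal_iff (by positivity),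
      Real.div_rpow Real.pi_pos.le hN0.le, Real.mul_rpow (by norm_num) hN0.le] at h1
    have h2 : (N : ℝ) ^ δ * ((N : ℝ) ^ σ * (N : ℝ) ^ (1 / α)) * (N : ℝ) ^ (1 / 3 : ℝ) = N := by
      rw [← Real.rpow_add hN0, ← Real.rpow_add hN0, ← Real.rpow_add hN0]
      conv_rhs => rw [← Real.rpow_one (N : ℝ)]
      congr 1
      rw [hδ]
      ring
    have hA : 0 < (N : ℝ) ^ σ * (N : ℝ) ^ (1 / α) := by positivity
    have hB : 0 < (N : ℝ) ^ (1 / 3 : ℝ) := by positivity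
    have hP : 0 < π ^ (1 / 3 : ℝ) := by positivity
    rw [hK, le_div_iff₀ hP]
    have h3 : (N : ℝ) / (2 * π) * (π ^ (1 / 3 : ℝ) / (N : ℝ) ^ (1 / 3 : ℝ)) =
        (N : ℝ) ^ δ * ((N : ℝ) ^ σ * (N : ℝ) ^ (1 / α)) * π ^ (1 / 3 : ℝ) / (2 * π) := by
      nth_rw 1 [← h2]
      field_simp
    rw [h3, div_le_iff₀ Real.two_pi_pos] at h1
    refine le_of_mul_le_mul_right ?_ hA
    linarith
  have hlim := (tendsto_rpow_atTop hδ0).comp tendsto_natCast_atTop_atTop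
  obtain ⟨N, hN, hN1⟩ := ((hlim.eventually_gt_atTop K).and (Filter.eventually_ge_atTop 1)).exists
  exact absurd (hbound N hN1) (not_le.2 hN)

end TorusStrichartz

theorem mainTheorem2 :
    (∀ (N : ℕ) (γ₀ : TorusStrichartz.L2 →L[ℂ] TorusStrichartz.L2),
      ∃ F : ℝ × TorusStrichartz.Circ → ℂ,
        TorusStrichartz.Represents F (TorusStrichartz.renDensityAt N γ₀)) ∧
    (∀ α σ : ℝ, 2 ≤ α → α ≤ 3 → (α = 3 → 1 / 3 ≤ σ) → (α < 3 → 2 / 3 - 1 / α < σ) →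
      TorusStrichartz.L3Estimate α σ) ∧
    (∀ α σ : ℝ, 3 / 2 ≤ α → α ≤ 3 → σ < 2 / 3 - 1 / α →
      ¬ TorusStrichartz.L3Estimate α σ) :=
  ⟨fun N γ₀ => ⟨_, TorusStrichartz.represents_trigDensity N γ₀⟩,
    fun _ _ h2 h3 h h' => TorusStrichartz.l3Estimate_of_le h2 h3 h h',
    fun _ _ h2 _ h => TorusStrichartz.not_l3Estimate (by linarith) h⟩
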